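/- **Setting.** Let $N\ge 0$ be an integer, $I=\{1,\dots,N\}$, and let $a,b,\omega$ be real with $a,b\ge 0$, $\omega>0$. Let $V=\mathbb R^N$ with standard basis $\varepsilon_1,\dots,\varepsilon_N$ and standard form $\langle\cdot,\cdot\rangle$; $R_+=\{\varepsilon_i-\varepsilon_j: i<j\}$, $R_-=-R_+$, $\alpha_j=\varepsilon_j-\varepsilon_{j+1}$ for $1\le j\le N-1$, $\alpha^\vee=2\alpha/\langle\alpha,\alpha\rangle$, $Q_+=\sum_j\mathbb Z_{\ge 0}\alpha_j$, $\rho=\frac12\sum_{\alpha\in R_+}\alpha$, $1^N=\sum_i\varepsilon_i$. The Weyl group $W\cong\mathfrak S_N$, generated by the reflections $s_j$ in the $\alpha_j$, permutes the $\varepsilon_i$; for $w\in W$ put $R_w=R_+\cap w^{-1}R_-$ and $\ell(w)=|R_w|$. Let $P=\bigoplus_i\mathbb Z_{\ge0}\varepsilon_i$ (compositions) and $P_+=\{\mu\in P:\mu_1\ge\dots\ge\mu_N\}$ (partitions), $|\mu|=\sum_i\mu_i$. For $\mu\in P$ let $w_\mu$ be the shortest element of $W$ with $w_\mu^{-1}(\mu)\in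 P_+$, $\mu^+=w_\mu^{-1}(\mu)$ the unique partition in the orbit $W(\mu)$, and $\rho(\mu)=w_\mu(\rho)$. Write $\nu\preceq\mu$ if either $\nu\notin W(\mu^+)$ and $\nu^+$ is strictly smaller than $\mu^+$ in the dominance order of partitions of equal degree, or $\nu\in W(\mu^+)$ and $\mu-\nu\in Q_+$. On $\mathbb C[x]=\mathbb C[x_1,\dots,x_N]$ let $K_{jk}$ exchange $x_j$ and $x_k$, let $t_j$ be $x_j\mapsto -x_j$, and let $$\nabla^{(A)}_j=\partial_{x_j}+a\sum_{k\ne j}\frac{1}{x_j-x_k}(1-K_{jk}),$$ $$\nabla^{(B)}_j=\partial_{x_j}+a\sum_{k\ne j}\Bigl(\frac{1}{x_j-x_k}(1-K_{jk})+\frac1{x_j+x_k}(1-t_jt_kK_{jk})\Bigr)+\frac b{x_j}(1-t_j),$$ $$\alpha_j^{(\cdot)\dagger}=x_j-\tfrac1{2\omega}\nabla_j^{(\cdot)},\qquad \alpha_j^{(\cdot)}=\tfrac1{2\omega}\nabla_j^{(\cdot)},$$ $$d^{(A)}_j=2\omega\,\alpha_j^{(A)\dagger}\alpha_j^{(A)}+a\sum_{k>j}K_{jk},\qquad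 d^{(B)}_j=2\omega\,\alpha_j^{(B)\dagger}\alpha_j^{(B)}+a\sum_{k>j}(1+t_jt_k)K_{jk}+b\,t_j,$$ and $S_j^{(\cdot)}=[K_{j,j+1},d_j^{(\cdot)}]$ for $1\le j\le N-1$. For $\lambda\in P$ put $d^{(\cdot)\lambda}=\sum_j\lambda_jd^{(\cdot)}_j$. For $\mu\in P$, the non-symmetric Hermite polynomial $h^{(A)}_\mu$ and the non-symmetric Laguerre polynomial $h^{(B)}_\mu$ are the polynomials of the form $$x^\mu+\text{a linear combination of the }x^\nu\text{ with }\nu\neq\mu\text{ and }(\nu\preceq\mu\text{ or }|\nu|<|\mu|)$$ such that, for all $\lambda\in P$, $$d^{(A)\lambda}h^{(A)}_\mu=\langle\lambda,\mu+a\rho(\mu)+\tfrac12a(N-1)1^N\rangle h^{(A)}_\mu,$$ $$d^{(B)\lambda}h^{(B)}_\mu=\langle\lambda,\mu+2a\rho(\mu)+(a(N-1)+b)1^N\rangle h^{(B)}_\mu .$$ **Proposition.** Let $\mu^+\in P_+$ and $\mu\in W(\mu^+)$, let $w_\mu=s_{j_l}\cdots s_{j_2}s_{j_1}$, $l=\ell(w_\mu)$,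 be any reduced expression of $w_\mu$, and put $S^{(\cdot)}_{w_\mu}=S^{(\cdot)}_{j_l}\cdots S^{(\cdot)}_{j_2}S^{(\cdot)}_{j_1}$. Put $$c^{(A)}_{w_\mu}=\prod_{\alpha\in R_{w_\mu}}\frac{\langle\alpha^\vee,\mu^++a\rho\rangle^2-a^2}{\langle\alpha^\vee,\mu^++a\rho\rangle},\qquad c^{(B)}_{w_\mu}=\prod_{\alpha\in R_{w_\mu}}\frac{\langle\alpha^\vee,\mu^++2a\rho\rangle^2-a^2\bigl(1+(-1)^{\langle\alpha^\vee,\mu^+\rangle}\bigr)^2}{\langle\alpha^\vee,\mu^++2a\rho\rangle}.$$ Then, for each of the two types $(A)$ and $(B)$, the polynomials $h_\mu^{(\cdot)}$ and $h_{\mu^+}^{(\cdot)}$ exist and are unique, all denominators in $c^{(\cdot)}_{w_\mu}$ are nonzero, $c^{(\cdot)}_{w_\mu}\ne0$, and $$h^{(A)}_\mu=(c^{(A)}_{w_\mu})^{-1}S^{(A)}_{w_\mu}h^{(A)}_{\mu^+},\qquad h^{(B)}_\mu=(c^{(B)}_{w_\mu})^{-1}S^{(B)}_{w_\mu}h^{(B)}_{\mu^+}.$$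 -/

import Mathlib

namespace Calogero

open MvPolynomial

noncomputable section

/-! ### The root system of type `A_{N-1}`

The ambient space is `V = ℝ^N`, realised as `Fin N → ℝ` with the standard bilinear form
`dotProduct`.  The set `I = {1, …, N}` is `Fin N`, and the set `{1, …, N-1}` indexing the simple
roots is `Fin (N - 1)`. -/

/-- The index `j` of `I`, for `j` the index of a simple root. -/
def lo {N : ℕ} (j : Fin (N - 1)) : Fin N := ⟨j.1, by omega⟩

/-- The index `j + 1` of `I`, for `j` the index of a simple root. -/
def hi {N : ℕ} (j : Fin (N - 1)) : Fin N := ⟨j.1 + 1, by omega⟩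

/-- The basis vector `ε_j`. -/
def eps {N : ℕ} (j : Fin N) : Fin N → ℝ := Pi.single j 1

/-- The simple root `α_j = ε_j - ε_{j+1}`. -/
def simpleRoot {N : ℕ} (j : Fin (N - 1)) : Fin N → ℝ := eps (lo j) - eps (hi j)

open Classical in
/-- The positive roots `ε_i - ε_j`, `i < j`. -/
def posRoots (N : ℕ) : Finset (Fin N → ℝ) :=
  (Finset.univ.filter fun p : Fin N × Fin N => p.1 < p.2).image fun p => eps p.1 - eps p.2

/-- The coroot `α^∨ = 2 α / ⟨α, α⟩`. -/
def coroot {N : ℕ} (α : Fin N → ℝ) : Fin N → ℝ := (2 / (α ⬝ᵥ α)) • α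

/-- The reflection `s_α(v) = v - ⟨α^∨, v⟩ α`. -/
def reflect {N : ℕ} (α v : Fin N → ℝ) : Fin N → ℝ := v - (coroot α ⬝ᵥ v) • α

/-- The action of the Weyl group `W = 𝔖_N` on `V`, with `w(ε_j) = ε_{w(j)}`. -/
def act {N : ℕ} (w : Equiv.Perm (Fin N)) (v : Fin N → ℝ) : Fin N → ℝ := fun i => v (w⁻¹ i)

/-- The simple reflection `s_j` as an element of `W = 𝔖_N`. -/
def simpleRefl {N : ℕ} (j : Fin (N - 1)) : Equiv.Perm (Fin N) := Equiv.swap (lo j) (hi j)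

/-- The element `s_j` of `𝔖_N` acts on `V` as the reflection in the simple root `α_j`. -/
theorem act_simpleRefl {N : ℕ} (j : Fin (N - 1)) (v : Fin N → ℝ) :
    act (simpleRefl j) v = reflect (simpleRoot j) v := by
  have hne : lo j ≠ hi j := by simp [lo, hi, Fin.ext_iff]
  have h2 : simpleRoot j ⬝ᵥ simpleRoot j = 2 := by
    simp [simpleRoot, eps, dotProduct_sub, hne, hne.symm]
    norm_num
  funext i
  simp only [act, simpleRefl, reflect, coroot, h2, Equiv.swap_inv, Equiv.swap_apply_def]
  by_cases h1 : i = lo j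
  · subst h1
    simp [simpleRoot, eps, sub_dotProduct, hne]
  · by_cases h3 : i = hi j
    · subst h3
      simp [simpleRoot, eps, sub_dotProduct, hne.symm]
    · simp [simpleRoot, eps, h1, h3]

open Classical in
/-- The set `R_w = R_+ ∩ w⁻¹ R_-`. -/
def inversions {N : ℕ} (w : Equiv.Perm (Fin N)) : Finset (Fin N → ℝ) :=
  (posRoots N).filter fun α => -(act w α) ∈ posRoots N

/-- The length `ℓ(w) = |R_w|`. -/
def length {N : ℕ} (w : Equiv.Perm (Fin N)) : ℕ := (inversions w).card

/-- `ρ`, half the sum of the positive roots. -/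
def rho (N : ℕ) : Fin N → ℝ := (1 / 2 : ℝ) • ∑ α ∈ posRoots N, α

/-- `Q_+`, the nonnegative integer combinations of the simple roots. -/
def rootCone (N : ℕ) : AddSubmonoid (Fin N → ℝ) :=
  AddSubmonoid.closure (Set.range (simpleRoot (N := N)))

/-! ### Compositions and partitions -/

/-- Compositions: the elements of `P = ⨁ ℤ_{≥0} ε_j`; they are also the exponents of monomials. -/
abbrev Comp (N : ℕ) := Fin N →₀ ℕ

/-- A composition as a vector of `V`. -/
def Comp.vec {N : ℕ} (μ : Comp N) : Fin N → ℝ := fun i => (μ i : ℝ)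

/-- The action of `W` on compositions, `w(ε_j) = ε_{w(j)}`. -/
def Comp.act {N : ℕ} (w : Equiv.Perm (Fin N)) (μ : Comp N) : Comp N := Finsupp.equivMapDomain w μ

/-- `μ` lies in `P_+`: `μ_1 ≥ μ_2 ≥ ⋯ ≥ μ_N`. -/
def Comp.IsPartition {N : ℕ} (μ : Comp N) : Prop := Antitone fun i => μ i

/-- The orbit `W(μ)`. -/
def Comp.orbit {N : ℕ} (μ : Comp N) : Set (Comp N) := Set.range fun w => Comp.act w μ

theorem exists_shortest {N : ℕ} (μ : Comp N) :
    ∃ w : Equiv.Perm (Fin N), (Comp.act w⁻¹ μ).IsPartition ∧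
      ∀ w' : Equiv.Perm (Fin N), (Comp.act w'⁻¹ μ).IsPartition → length w ≤ length w' := by
  classical
  let s : Finset (Equiv.Perm (Fin N)) :=
    Finset.univ.filter fun w => (Comp.act w⁻¹ μ).IsPartition
  have hs : s.Nonempty := by
    refine ⟨Tuple.sort fun i => OrderDual.toDual (μ i), ?_⟩
    simp only [s, Finset.mem_filter, Finset.mem_univ, true_and]
    intro i j hij
    exact Tuple.monotone_sort (fun i => OrderDual.toDual (μ i)) hij
  obtain ⟨w, hw, hmin⟩ := s.exists_min_image length hs
  simp only [s, Finset.mem_filter, Finset.mem_univ, true_and] at hw hmin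
  exact ⟨w, hw, hmin⟩

/-- `w_μ`, the shortest element of `W` with `w_μ⁻¹(μ) ∈ P_+`. -/
def shortest {N : ℕ} (μ : Comp N) : Equiv.Perm (Fin N) := (exists_shortest μ).choose

/-- `μ^+`, the partition in the orbit of `μ`. -/
def Comp.plus {N : ℕ} (μ : Comp N) : Comp N := Comp.act (shortest μ)⁻¹ μ

/-- `ρ(μ) = w_μ(ρ)`. -/
def rhoAt {N : ℕ} (μ : Comp N) : Fin N → ℝ := act (shortest μ) (rho N)

/-- The strict dominance order. -/
def DomLT {N : ℕ} (ν μ : Comp N) : Prop :=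
  ν ≠ μ ∧ ν.degree = μ.degree ∧
    ∀ l : Fin N, ∑ k ∈ Finset.Iic l, ν k ≤ ∑ k ∈ Finset.Iic l, μ k

/-- The order `ν ⪯ μ` on compositions. -/
def PrecEq {N : ℕ} (ν μ : Comp N) : Prop :=
  (ν ∉ μ.plus.orbit ∧ DomLT ν.plus μ.plus) ∨
    (ν ∈ μ.plus.orbit ∧ μ.vec - ν.vec ∈ rootCone N)

/-! ### Operators on `ℂ[x]` -/

/-- The polynomial ring `ℂ[x_1, …, x_N]`. -/
abbrev Poly (N : ℕ) := MvPolynomial (Fin N) ℂ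

/-- Linear operators on `ℂ[x]`; the product is composition. -/
abbrev Op (N : ℕ) := Module.End ℂ (Poly N)

/-- The coordinate exchange `K_{jk}`. -/
def exch {N : ℕ} (j k : Fin N) : Poly N →ₐ[ℂ] Poly N := rename (Equiv.swap j k)

/-- The reflection `t_j : x_j ↦ -x_j`. -/
def flip {N : ℕ} (j : Fin N) : Poly N →ₐ[ℂ] Poly N := aeval fun i => if i = j then -X i else X i

/-- If `p` divides `x_i - σ(x_i)` for all `i`, then `p` divides `f - σ(f)` for all `f`. -/
theorem dvd_sub_map {N : ℕ} {p : Poly N} {σ : Poly N →ₐ[ℂ] Poly N}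
    (h : ∀ i, p ∣ X i - σ (X i)) (f : Poly N) : p ∣ f - σ f := by
  have key : (Ideal.Quotient.mkₐ ℂ (Ideal.span {p})) =
      (Ideal.Quotient.mkₐ ℂ (Ideal.span {p})).comp σ := by
    apply MvPolynomial.algHom_ext
    intro i
    simp only [AlgHom.comp_apply, Ideal.Quotient.mkₐ_eq_mk]
    rw [Ideal.Quotient.eq, Ideal.mem_span_singleton]
    exact h i
  have := congrArg (fun φ => φ f) key
  simp only [AlgHom.comp_apply, Ideal.Quotient.mkₐ_eq_mk] at this
  rwa [Ideal.Quotient.eq, Ideal.mem_span_singleton] at this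

/-- The operator `p⁻¹ (1 - σ)`: the image of `f` is the polynomial `q` with `p q = f - σ(f)`. -/
def divDiff {N : ℕ} (p : Poly N) (σ : Poly N →ₐ[ℂ] Poly N) (hp : p ≠ 0)
    (h : ∀ i, p ∣ X i - σ (X i)) : Op N where
  toFun f := (dvd_sub_map h f).choose
  map_add' f g := by
    apply mul_left_cancel₀ hp
    rw [mul_add, ← (dvd_sub_map h (f + g)).choose_spec, ← (dvd_sub_map h f).choose_spec,
      ← (dvd_sub_map h g).choose_spec, map_add]
    ring
  map_smul' c f := by
    apply mul_left_cancel₀ hp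
    rw [RingHom.id_apply, mul_smul_comm, ← (dvd_sub_map h (c • f)).choose_spec,
      ← (dvd_sub_map h f).choose_spec, map_smul, smul_sub]

theorem X_sub_X_ne_zero {N : ℕ} {j k : Fin N} (h : k ≠ j) : (X j - X k : Poly N) ≠ 0 :=
  sub_ne_zero.2 fun e => h (X_injective e).symm

theorem X_add_X_ne_zero {N : ℕ} (j k : Fin N) : (X j + X k : Poly N) ≠ 0 := by
  intro h
  have := congrArg (eval fun _ => (1 : ℂ)) h
  simp only [map_add, eval_X, map_zero] at this
  norm_num at this

theorem dvd_exch {N : ℕ} (j k i : Fin N) : (X j - X k : Poly N) ∣ X i - exch j k (X i) := by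
  simp only [exch, rename_X, Equiv.swap_apply_def]
  split_ifs with h1 h2
  · simp [h1]
  · subst h2
    exact ⟨-1, by ring⟩
  · simp

theorem dvd_flip_exch {N : ℕ} {j k : Fin N} (h : k ≠ j) (i : Fin N) :
    (X j + X k : Poly N) ∣ X i - ((flip j).comp ((flip k).comp (exch j k))) (X i) := by
  simp only [exch, flip, AlgHom.comp_apply, rename_X, Equiv.swap_apply_def]
  split_ifs with h1 h2
  · simp [h1, h]
  · simp [h2, h.symm, add_comm]
  · simp [h1, h2]

theorem dvd_flip {N : ℕ} (j i : Fin N) : (X j : Poly N) ∣ X i - flip j (X i) := by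
  simp only [flip, aeval_X]
  split_ifs with h1
  · simp [h1, ← two_mul]
  · simp

/-- `K_{jk}` as an operator. -/
def Kop {N : ℕ} (j k : Fin N) : Op N := (exch j k).toLinearMap

/-- `t_j` as an operator. -/
def Top {N : ℕ} (j : Fin N) : Op N := (flip j).toLinearMap

/-- Multiplication by `x_j`. -/
def Xop {N : ℕ} (j : Fin N) : Op N := LinearMap.mulLeft ℂ (X j)

/-- The Dunkl operator of type `A`. -/
def dunklA {N : ℕ} (a : ℝ) (j : Fin N) : Op N :=
  (pderiv j).toLinearMap + (a : ℂ) • ∑ k : {k : Fin N // k ≠ j},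
    divDiff (X j - X k.1) (exch j k.1) (X_sub_X_ne_zero k.2) (dvd_exch j k.1)

/-- The Dunkl operator of type `B`. -/
def dunklB {N : ℕ} (a b : ℝ) (j : Fin N) : Op N :=
  (pderiv j).toLinearMap + (a : ℂ) • ∑ k : {k : Fin N // k ≠ j},
    (divDiff (X j - X k.1) (exch j k.1) (X_sub_X_ne_zero k.2) (dvd_exch j k.1)
      + divDiff (X j + X k.1) ((flip j).comp ((flip k.1).comp (exch j k.1)))
          (X_add_X_ne_zero j k.1) (dvd_flip_exch k.2))
    + (b : ℂ) • divDiff (X j) (flip j) (X_ne_zero j) (dvd_flip j)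

/-- The annihilation-like operator `α = (2ω)⁻¹ ∇`, for `∇` a Dunkl operator. -/
def annih {N : ℕ} (ω : ℝ) (D : Op N) : Op N := (1 / (2 * ω) : ℂ) • D

/-- The creation-like operator `α_j† = x_j - (2ω)⁻¹ ∇_j`. -/
def creat {N : ℕ} (ω : ℝ) (D : Op N) (j : Fin N) : Op N := Xop j - (1 / (2 * ω) : ℂ) • D

/-- The Cherednik operator `d_j` of type `A`. -/
def cherednikA {N : ℕ} (a ω : ℝ) (j : Fin N) : Op N :=
  (2 * ω : ℂ) • (creat ω (dunklA a j) j * annih ω (dunklA a j))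
    + (a : ℂ) • ∑ k ∈ Finset.Ioi j, Kop j k

/-- The Cherednik operator `d_j` of type `B`. -/
def cherednikB {N : ℕ} (a b ω : ℝ) (j : Fin N) : Op N :=
  (2 * ω : ℂ) • (creat ω (dunklB a b j) j * annih ω (dunklB a b j))
    + (a : ℂ) • ∑ k ∈ Finset.Ioi j, (1 + Top j * Top k) * Kop j k
    + (b : ℂ) • Top j

/-- The operator `d^λ = ∑_j λ_j d_j`. -/
def weighted {N : ℕ} (d : Fin N → Op N) (lam : Comp N) : Op N := ∑ j, (lam j : ℂ) • d j

/-- The braid operator `S_j = [K_j, d_j]`, with `K_j = K_{j,j+1}`. -/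
def braid {N : ℕ} (d : Fin N → Op N) (j : Fin (N - 1)) : Op N :=
  Kop (lo j) (hi j) * d (lo j) - d (lo j) * Kop (lo j) (hi j)

/-! ### Non-symmetric Hermite and Laguerre polynomials -/

/-- `h = x^μ + (terms x^ν with ν ⪯ μ, ν ≠ μ, or |ν| < |μ|)`. -/
def IsMonicTriangular {N : ℕ} (μ : Comp N) (h : Poly N) : Prop :=
  coeff μ h = 1 ∧ ∀ ν, ν ≠ μ → coeff ν h ≠ 0 → PrecEq ν μ ∨ ν.degree < μ.degree

/-- The defining property of `h_μ^{(A)}`. -/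
def IsHermite {N : ℕ} (a ω : ℝ) (μ : Comp N) (h : Poly N) : Prop :=
  IsMonicTriangular μ h ∧ ∀ lam : Comp N,
    weighted (cherednikA a ω) lam h =
      ((lam.vec ⬝ᵥ (μ.vec + a • rhoAt μ + (1 / 2 * a * ((N : ℝ) - 1)) • 1) : ℝ) : ℂ) • h

/-- The defining property of `h_μ^{(B)}`. -/
def IsLaguerre {N : ℕ} (a b ω : ℝ) (μ : Comp N) (h : Poly N) : Prop :=
  IsMonicTriangular μ h ∧ ∀ lam : Comp N,
    weighted (cherednikB a b ω) lam h =
      ((lam.vec ⬝ᵥ (μ.vec + (2 * a) • rhoAt μ + (a * ((N : ℝ) - 1) + b) • 1) : ℝ) : ℂ) • h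

/-- The non-symmetric multivariable Hermite polynomial `h_μ^{(A)}`. -/
def hermite {N : ℕ} (a ω : ℝ) (μ : Comp N) : Poly N := Classical.epsilon (IsHermite a ω μ)

/-- The non-symmetric multivariable Laguerre polynomial `h_μ^{(B)}`. -/
def laguerre {N : ℕ} (a b ω : ℝ) (μ : Comp N) : Poly N := Classical.epsilon (IsLaguerre a b ω μ)

/-- `⟨α^∨, μ + κ ρ⟩`. -/
def pair {N : ℕ} (κ : ℝ) (α : Fin N → ℝ) (μ : Comp N) : ℝ := coroot α ⬝ᵥ (μ.vec + κ • rho N)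

/-- `(-1)^{⟨α^∨, μ⟩}`; for a root `α` the exponent is an integer, so that the floor only
changes its type. -/
def parity {N : ℕ} (α : Fin N → ℝ) (μ : Comp N) : ℝ := (-1) ^ ⌊coroot α ⬝ᵥ μ.vec⌋

/-- The constant `c_w^{(A)}`, with `μp` the partition. -/
def cA {N : ℕ} (a : ℝ) (w : Equiv.Perm (Fin N)) (μp : Comp N) : ℝ :=
  ∏ α ∈ inversions w, ((pair a α μp) ^ 2 - a ^ 2) / pair a α μp

/-- The constant `c_w^{(B)}`, with `μp` the partition. -/
def cB {N : ℕ} (a : ℝ) (w : Equiv.Perm (Fin N)) (μp : Comp N) : ℝ :=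
  ∏ α ∈ inversions w,
    ((pair (2 * a) α μp) ^ 2 - a ^ 2 * (1 + parity α μp) ^ 2) / pair (2 * a) α μp

/-- The list `[j_l, …, j_1]` is a reduced expression `w = s_{j_l} ⋯ s_{j_1}`, `l = ℓ(w)`. -/
def IsReducedWord {N : ℕ} (w : Equiv.Perm (Fin N)) (js : List (Fin (N - 1))) : Prop :=
  (js.map simpleRefl).prod = w ∧ js.length = length w

/-- `S_{j_l} ⋯ S_{j_1}` for the list `[j_l, …, j_1]`. -/
def braidWord {N : ℕ} (d : Fin N → Op N) (js : List (Fin (N - 1))) : Op N :=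
  (js.map (braid d)).prod

end

end Calogero

namespace Calogero

open MvPolynomial

noncomputable section

/-! ### Divided differences -/

/-! Both types are treated at once by a parameter `τ` with `τ² = τ`: `τ = 0`, `b = 0` gives type A
and `τ = 1` gives type B, the sign changes entering only as `twist τ j = τ t_j`.

The Dunkl operators kill `1` and have explicit commutators with the coordinates (`dunkl_X_mul`). An
operator is determined by such data (`op_eq`), so their equivariance and commutativity
(`dunkl_comm`) reduce to identities between exchanges and sign changes. Hence the `d_j` commute
(`cherednik_comm`) and satisfy relations of degenerate affine Hecke type with `K_{j,j+1}`
(`Kop_mul_cherednik_lo`).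

On monomials the `d_j` are triangular for `Below` (`cherednik_monomial`), and their diagonal entries
separate compositions (`spec_injective`). Every maximal exponent of a joint eigenvector is therefore
fixed by its eigenvalues, so each joint eigenspace belonging to a composition is a line, spanned by
a monic triangular polynomial (`IsTriangular.existsUnique`).

Let `μ_j > μ_{j+1}`, let `f` and `g` be the monic eigenvectors for `μ` and `s_j μ`, and let `x`, `y`
be the eigenvalues of `d_j`, `d_{j+1}` on `f`. The Hecke relations make `K g + (aε / (x - y)) g` a
joint eigenvector for `μ`, hence equal to `f`, where `ε` is the scalar by which `1 + τ t_j t_{j+1}`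
acts. On the span of `f` and `g` this gives `S_j f = (((x - y)² - a²ε²) / (x - y)) g`
(`braid_apply`). Along a reduced word each letter creates one inversion, whose root supplies exactly
this factor (`braidWord_apply`). The factors are nonzero because `w_μ` is the stable sorting
permutation, so that `x - y ≥ 1 + (1 + τ)a` at every inversion. -/

theorem mul_divDiff {N : ℕ} {p : Poly N} {σ : Poly N →ₐ[ℂ] Poly N} (hp : p ≠ 0)
    (h : ∀ i, p ∣ X i - σ (X i)) (f : Poly N) : p * divDiff p σ hp h f = f - σ f :=
  (dvd_sub_map h f).choose_spec.symm

theorem divDiff_eq_of_mul_eq {N : ℕ} {p : Poly N} {σ : Poly N →ₐ[ℂ] Poly N} (hp : p ≠ 0)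
    (h : ∀ i, p ∣ X i - σ (X i)) {f q : Poly N} (hq : p * q = f - σ f) :
    divDiff p σ hp h f = q :=
  mul_left_cancel₀ hp (by rw [mul_divDiff, hq])

theorem divDiff_mul {N : ℕ} {p : Poly N} {σ : Poly N →ₐ[ℂ] Poly N} (hp : p ≠ 0)
    (h : ∀ i, p ∣ X i - σ (X i)) (g f : Poly N) :
    divDiff p σ hp h (g * f) = g * divDiff p σ hp h f + divDiff p σ hp h g * σ f := by
  apply divDiff_eq_of_mul_eq
  rw [mul_add, mul_left_comm, mul_divDiff, ← mul_assoc, mul_divDiff, map_mul]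
  ring

theorem divDiff_one {N : ℕ} {p : Poly N} {σ : Poly N →ₐ[ℂ] Poly N} (hp : p ≠ 0)
    (h : ∀ i, p ∣ X i - σ (X i)) : divDiff p σ hp h 1 = 0 :=
  divDiff_eq_of_mul_eq hp h (by simp)

/-- The divided difference `(x_j - x_k)⁻¹ (1 - K_{jk})`, and `0` for `k = j`. -/
def diffMinus {N : ℕ} (j k : Fin N) : Op N :=
  if h : k ≠ j then divDiff (X j - X k) (exch j k) (X_sub_X_ne_zero h) (dvd_exch j k) else 0

/-- The divided difference `(x_j + x_k)⁻¹ (1 - t_j t_k K_{jk})`, and `0` for `k = j`. -/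
def diffPlus {N : ℕ} (j k : Fin N) : Op N :=
  if h : k ≠ j then divDiff (X j + X k) ((flip j).comp ((flip k).comp (exch j k)))
    (X_add_X_ne_zero j k) (dvd_flip_exch h) else 0

/-- The divided difference `x_j⁻¹ (1 - t_j)`. -/
def diffFlip {N : ℕ} (j : Fin N) : Op N := divDiff (X j) (flip j) (X_ne_zero j) (dvd_flip j)

theorem mul_diffMinus {N : ℕ} {j k : Fin N} (h : k ≠ j) (f : Poly N) :
    (X j - X k) * diffMinus j k f = f - Kop j k f := by
  rw [diffMinus, dif_pos h, mul_divDiff]; rfl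

theorem mul_diffPlus {N : ℕ} {j k : Fin N} (h : k ≠ j) (f : Poly N) :
    (X j + X k) * diffPlus j k f = f - (Top j * Top k * Kop j k) f := by
  rw [diffPlus, dif_pos h, mul_divDiff]; rfl

theorem mul_diffFlip {N : ℕ} (j : Fin N) (f : Poly N) :
    X j * diffFlip j f = f - Top j f := by
  rw [diffFlip, mul_divDiff]; rfl

theorem diffMinus_X_mul {N : ℕ} {j l : Fin N} (h : l ≠ j) (k : Fin N) (f : Poly N) :
    diffMinus j l (X k * f) = X k * diffMinus j l f +
      (if k = j then Kop j l f else if k = l then -Kop j l f else 0) := by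
  have key : diffMinus j l (X k) = if k = j then 1 else if k = l then -1 else 0 := by
    apply mul_left_cancel₀ (X_sub_X_ne_zero h)
    rw [mul_diffMinus h]
    simp only [Kop, exch, AlgHom.toLinearMap_apply, rename_X, Equiv.swap_apply_def]
    split_ifs with h1 h2
    · simp [h1]
    · simp [h2]
    · simp
  have := divDiff_mul (X_sub_X_ne_zero h) (dvd_exch j l) (X k) f
  simp only [diffMinus, dif_pos h] at key ⊢
  rw [this, key]
  congr 1
  split_ifs <;> simp [Kop]

theorem diffPlus_X_mul {N : ℕ} {j l : Fin N} (h : l ≠ j) (k : Fin N) (f : Poly N) :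
    diffPlus j l (X k * f) = X k * diffPlus j l f +
      (if k = j ∨ k = l then (Top j * Top l * Kop j l) f else 0) := by
  have key : diffPlus j l (X k) = if k = j ∨ k = l then 1 else 0 := by
    apply mul_left_cancel₀ (X_add_X_ne_zero j l)
    rw [mul_diffPlus h]
    simp only [Kop, exch, Top, flip, Module.End.mul_apply, AlgHom.toLinearMap_apply, rename_X,
      Equiv.swap_apply_def]
    by_cases h1 : k = j
    · simp [h1, h]
    · by_cases h2 : k = l
      · subst h2
        simp [h, h.symm, add_comm]
      · simp [h1, h2]
  have := divDiff_mul (X_add_X_ne_zero j l) (dvd_flip_exch h) (X k) f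
  simp only [diffPlus, dif_pos h] at key ⊢
  rw [this, key]
  congr 1
  split_ifs <;> simp [Kop, Top]

theorem diffFlip_X_mul {N : ℕ} (j k : Fin N) (f : Poly N) :
    diffFlip j (X k * f) = X k * diffFlip j f + (if k = j then (2 : ℂ) • Top j f else 0) := by
  have key : diffFlip j (X k) = if k = j then (2 : ℂ) • 1 else 0 := by
    apply mul_left_cancel₀ (X_ne_zero j)
    rw [mul_diffFlip]
    simp only [Top, flip, AlgHom.toLinearMap_apply, aeval_X]
    split_ifs with h1
    · simp [h1, two_smul, mul_add]
    · simp
  have := divDiff_mul (X_ne_zero j) (dvd_flip j) (X k) f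
  rw [diffFlip] at key ⊢
  rw [this, key]
  congr 1
  split_ifs <;> simp [Top]

/-! ### Operators determined by their commutators with the coordinates -/

/-- Every monomial is reached from `1` by multiplying by coordinates. The factor `m l` need not be
`X l`: an operator that permutes coordinates or changes their signs moves past `X l` only up to that
change. -/
theorem op_eq_zero {N : ℕ} {A : Op N} (m : Fin N → Poly N) (h1 : A 1 = 0)
    (h : ∀ l f, A (X l * f) = m l * A f) : A = 0 := by
  refine LinearMap.ext fun f => ?_
  rw [LinearMap.zero_apply]
  induction f using MvPolynomial.induction_on with
  | C c => rw [← mul_one (C c), ← smul_eq_C_mul, map_smul, h1, smul_zero]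
  | add p q hp hq => rw [map_add, hp, hq, add_zero]
  | mul_X p n hp => rw [mul_comm, h, hp, mul_zero]

theorem op_eq {N : ℕ} {A B : Op N} (m : Fin N → Poly N) (h1 : A 1 = B 1)
    (h : ∀ l f, A (X l * f) - B (X l * f) = m l * (A f - B f)) : A = B :=
  sub_eq_zero.1 (op_eq_zero m (by simp [h1]) (by simpa using h))

/-- The operator permuting the coordinates by `w`. -/
def permOp {N : ℕ} (w : Equiv.Perm (Fin N)) : Op N := (rename w : Poly N →ₐ[ℂ] Poly N).toLinearMap

theorem Kop_eq_permOp {N : ℕ} (j k : Fin N) : Kop j k = permOp (Equiv.swap j k) := rfl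

theorem permOp_mul {N : ℕ} (v w : Equiv.Perm (Fin N)) : permOp v * permOp w = permOp (v * w) :=
  LinearMap.ext fun f => rename_rename w v f

theorem permOp_X_mul {N : ℕ} (w : Equiv.Perm (Fin N)) (l : Fin N) (f : Poly N) :
    permOp w (X l * f) = X (w l) * permOp w f := by simp [permOp]

theorem permOp_one_apply {N : ℕ} (w : Equiv.Perm (Fin N)) : permOp w (1 : Poly N) = 1 := by
  simp [permOp]

theorem Top_one_apply {N : ℕ} (j : Fin N) : Top j (1 : Poly N) = 1 := by simp [Top]

/-- The sign with which `t_j` acts on `x_l`. -/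
def flipSign {N : ℕ} (j l : Fin N) : ℂ := if l = j then -1 else 1

theorem flipSign_mul_self {N : ℕ} (j l : Fin N) : flipSign j l * flipSign j l = 1 := by
  unfold flipSign; split_ifs <;> norm_num

theorem flipSign_perm {N : ℕ} (w : Equiv.Perm (Fin N)) (j l : Fin N) :
    flipSign (w j) (w l) = flipSign j l := by
  simp [flipSign]

theorem Top_X_mul {N : ℕ} (j l : Fin N) (f : Poly N) :
    Top j (X l * f) = flipSign j l • (X l * Top j f) := by
  simp only [Top, flip, flipSign, AlgHom.toLinearMap_apply, map_mul, aeval_X]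
  split_ifs <;> simp

theorem permOp_mul_Kop {N : ℕ} (w : Equiv.Perm (Fin N)) (j k : Fin N) :
    permOp w * Kop j k = Kop (w j) (w k) * permOp w := by
  rw [Kop_eq_permOp, Kop_eq_permOp, permOp_mul, permOp_mul, Equiv.swap_apply_apply]
  simp [mul_assoc]

theorem Kop_comm {N : ℕ} (j k : Fin N) : Kop j k = Kop k j := by
  rw [Kop_eq_permOp, Equiv.swap_comm, ← Kop_eq_permOp]

theorem Kop_mul_self {N : ℕ} (j k : Fin N) : Kop j k * Kop j k = 1 := by
  rw [Kop_eq_permOp, permOp_mul, Equiv.swap_mul_self]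
  exact LinearMap.ext fun f => rename_id_apply f

theorem Top_mul_self {N : ℕ} (j : Fin N) : Top j * Top j = 1 := by
  apply op_eq (fun l => X l)
  · simp [Top_one_apply]
  · intro l f
    simp only [Module.End.mul_apply, Module.End.one_apply, Top_X_mul, map_smul, smul_smul,
      flipSign_mul_self, one_smul, mul_sub]

theorem Top_comm {N : ℕ} (j k : Fin N) : Top j * Top k = Top k * Top j := by
  apply op_eq (fun l => (flipSign j l * flipSign k l) • X l)
  · simp [Top_one_apply]
  · intro l f
    simp only [Module.End.mul_apply, Top_X_mul, map_smul, smul_smul, mul_sub,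
      smul_mul_assoc, mul_comm (flipSign k l)]

theorem permOp_mul_Top {N : ℕ} (w : Equiv.Perm (Fin N)) (j : Fin N) :
    permOp w * Top j = Top (w j) * permOp w := by
  apply op_eq (fun l => flipSign j l • X (w l))
  · simp [Top_one_apply, permOp_one_apply]
  · intro l f
    simp only [Module.End.mul_apply, Top_X_mul, permOp_X_mul, map_smul, flipSign_perm, mul_sub,
      smul_mul_assoc]

/-! ### The Dunkl operators of both types -/

/-- The operator `τ t_j`, equal to `0` in type `A` and to `t_j` in type `B`. -/
def twist {N : ℕ} (τ : ℂ) (j : Fin N) : Op N := τ • Top j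

/-- The operator `a (1 + τ t_j t_k) K_{jk}`. -/
def exchPlus {N : ℕ} (τ a : ℂ) (j k : Fin N) : Op N :=
  a • ((1 + twist τ j * twist τ k) * Kop j k)

/-- The operator `a (1 - τ t_j t_k) K_{jk}`. -/
def exchMinus {N : ℕ} (τ a : ℂ) (j k : Fin N) : Op N :=
  a • ((1 - twist τ j * twist τ k) * Kop j k)

/-- The Dunkl operator; `τ = 0`, `b = 0` is type `A` and `τ = 1` is type `B`. -/
def dunkl {N : ℕ} (τ a b : ℂ) (j : Fin N) : Op N :=
  (pderiv j).toLinearMap + a • ∑ k ∈ Finset.univ.erase j, (diffMinus j k + τ • diffPlus j k)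
    + b • diffFlip j

theorem sum_subtype_ne {N : ℕ} {M : Type*} [AddCommMonoid M] (j : Fin N) (f : Fin N → M) :
    ∑ k : {k : Fin N // k ≠ j}, f k = ∑ k ∈ Finset.univ.erase j, f k :=
  (Finset.sum_subtype _ (by simp) f).symm

theorem dunklA_eq {N : ℕ} (a : ℝ) (j : Fin N) : dunklA a j = dunkl 0 a 0 j := by
  simp only [dunklA, dunkl, zero_smul, add_zero]
  rw [← sum_subtype_ne]
  congr 2
  refine Finset.sum_congr rfl fun k _ => ?_
  rw [diffMinus, dif_pos k.2]

theorem dunklB_eq {N : ℕ} (a b : ℝ) (j : Fin N) : dunklB a b j = dunkl 1 a b j := by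
  simp only [dunklB, dunkl, one_smul]
  rw [← sum_subtype_ne]
  congr 3
  refine Finset.sum_congr rfl fun k _ => ?_
  rw [diffMinus, diffPlus, dif_pos k.2, dif_pos k.2]

/-- The commutator of the Dunkl operator `∇_j` with the coordinate `x_k`. -/
def commXop {N : ℕ} (τ a b : ℂ) (j k : Fin N) : Op N :=
  if j = k then 1 + ∑ l ∈ Finset.univ.erase j, exchPlus τ a j l + (2 * b) • twist τ j
  else -exchMinus τ a j k

/-- The admissible parameters: those of type `A` or type `B`. -/
def IsType (τ b : ℂ) : Prop := τ = 0 ∧ b = 0 ∨ τ = 1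

theorem IsType.sq {τ b : ℂ} (h : IsType τ b) : τ * τ = τ := by
  rcases h with ⟨rfl, -⟩ | rfl <;> simp

theorem IsType.mul_b {τ b : ℂ} (h : IsType τ b) : b * τ = b := by
  rcases h with ⟨rfl, rfl⟩ | rfl <;> simp

theorem twist_mul_twist {N : ℕ} {τ b : ℂ} (h : IsType τ b) (j k : Fin N) :
    twist τ j * twist τ k = τ • (Top j * Top k) := by
  rw [twist, twist, smul_mul_smul_comm, h.sq]

theorem dunkl_one_apply {N : ℕ} (τ a b : ℂ) (j : Fin N) : dunkl τ a b j (1 : Poly N) = 0 := by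
  have h1 : ∀ k, diffMinus j k (1 : Poly N) = 0 := fun k => by
    by_cases h : k = j
    · simp [diffMinus, h]
    · rw [diffMinus, dif_pos h, divDiff_one]
  have h2 : ∀ k, diffPlus j k (1 : Poly N) = 0 := fun k => by
    by_cases h : k = j
    · simp [diffPlus, h]
    · rw [diffPlus, dif_pos h, divDiff_one]
  have h3 : diffFlip j (1 : Poly N) = 0 := divDiff_one _ _
  simp [dunkl, LinearMap.sum_apply, h1, h2, h3]

/-- The twisted Leibniz rule for each divided difference, summed. Together with `dunkl_one_apply` it
carries all the commutation relations; the divided differences themselves return only for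
triangularity. -/
theorem dunkl_X_mul {N : ℕ} {τ b : ℂ} (h : IsType τ b) (a : ℂ) (j k : Fin N) (f : Poly N) :
    dunkl τ a b j (X k * f) = X k * dunkl τ a b j f + commXop τ a b j k f := by
  have hm : ∀ l ∈ Finset.univ.erase j, (diffMinus j l + τ • diffPlus j l) (X k * f) =
      X k * (diffMinus j l + τ • diffPlus j l) f + (if k = j then
        ((1 + twist τ j * twist τ l) * Kop j l) f else if k = l then
        -((1 - twist τ j * twist τ l) * Kop j l) f else 0) := by
    intro l hl
    have hl' : l ≠ j := Finset.ne_of_mem_erase hl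
    simp only [LinearMap.add_apply, LinearMap.smul_apply, diffMinus_X_mul hl',
      diffPlus_X_mul hl', twist_mul_twist h]
    by_cases h1 : k = j
    · simp [h1, add_mul, mul_add, mul_assoc]; abel
    · by_cases h2 : k = l
      · simp [h2, hl', sub_mul, mul_add, mul_assoc]; abel
      · simp [h1, h2, mul_add]
  have hf : b • diffFlip j (X k * f) = X k * (b • diffFlip j f) +
      (if k = j then ((2 * b) • twist τ j) f else 0) := by
    rw [diffFlip_X_mul]
    split_ifs
    · rw [smul_add, mul_smul_comm, smul_smul, twist, smul_smul, mul_assoc 2, h.mul_b, mul_comm b]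
      rfl
    · simp
  simp only [LinearMap.add_apply, LinearMap.smul_apply] at hm
  simp only [dunkl, LinearMap.add_apply, LinearMap.smul_apply, LinearMap.sum_apply]
  rw [Finset.sum_congr rfl hm, hf, Finset.sum_add_distrib]
  simp only [Derivation.coeFn_coe, Derivation.leibniz, smul_eq_mul, pderiv_X, smul_add,
    mul_add, mul_smul_comm, Finset.mul_sum]
  by_cases h1 : k = j
  · subst h1
    simp only [commXop, if_true, LinearMap.add_apply, LinearMap.sum_apply, exchPlus,
      LinearMap.smul_apply, Pi.single_eq_same, Module.End.one_apply, Finset.smul_sum]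
    ring
  · simp only [commXop, if_neg h1, if_neg (Ne.symm h1), LinearMap.neg_apply, exchMinus,
      LinearMap.smul_apply, Pi.single_eq_of_ne h1]
    rw [Finset.sum_ite_eq, if_pos (by simp [h1]), smul_neg]
    ring

/-! ### Commutation relations -/

theorem op_neg_mul {N : ℕ} (A B : Op N) : -A * B = -(A * B) := neg_mul A B

theorem op_mul_neg {N : ℕ} (A B : Op N) : A * -B = -(A * B) := mul_neg A B

theorem op_neg_one_smul {N : ℕ} (A : Op N) : (-1 : ℂ) • A = -A :=
  LinearMap.ext fun f => by simp

theorem twist_comm {N : ℕ} (τ : ℂ) (j k : Fin N) :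
    twist τ j * twist τ k = twist τ k * twist τ j := by
  rw [twist, twist, smul_mul_smul_comm, smul_mul_smul_comm, Top_comm]

theorem permOp_mul_twist {N : ℕ} (τ : ℂ) (w : Equiv.Perm (Fin N)) (j : Fin N) :
    permOp w * twist τ j = twist τ (w j) * permOp w := by
  rw [twist, twist, mul_smul_comm, smul_mul_assoc, permOp_mul_Top]

theorem Kop_mul_twist {N : ℕ} (τ : ℂ) (j k l : Fin N) :
    Kop j k * twist τ l = twist τ (Equiv.swap j k l) * Kop j k :=
  permOp_mul_twist τ _ l

/-- For `τ = 0` the square of `twist τ j` is `0` and not `1`, so it cancels only next to a further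
twist; there idempotence of `τ` suffices. -/
theorem twist_mul_twist_mul_twist {N : ℕ} {τ b : ℂ} (h : IsType τ b) (j k : Fin N) :
    twist τ j * twist τ j * twist τ k = twist τ k := by
  rw [twist_mul_twist h, Top_mul_self, twist, smul_mul_smul_comm, h.sq, one_mul]

theorem twist_mul_mul_twist_self {N : ℕ} {τ b : ℂ} (h : IsType τ b) (j k : Fin N) :
    twist τ j * (twist τ k * twist τ k) = twist τ j := by
  rw [twist_mul_twist h, Top_mul_self, twist, smul_mul_smul_comm, h.sq, mul_one]

/-- The nontrivial case is `τ t_j (1 + τ t_j t_k) = τ (t_j + t_k) = (1 + τ t_j t_k) τ t_k`, with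
`K_{jk}` exchanging the two twists. -/
theorem twist_mul_exchPlus {N : ℕ} {τ b : ℂ} (h : IsType τ b) (a : ℂ) (i j k : Fin N) :
    twist τ i * exchPlus τ a j k = exchPlus τ a j k * twist τ i := by
  rw [exchPlus, mul_smul_comm, smul_mul_assoc, mul_assoc _ (Kop j k), Kop_mul_twist]
  congr 1
  simp only [← mul_assoc]
  congr 1
  have h1 := twist_mul_twist_mul_twist h (N := N)
  have h2 := twist_comm τ (N := N)
  have h4 := twist_mul_mul_twist_self h (N := N)
  rw [mul_add, add_mul, mul_one, one_mul]
  by_cases hij : i = j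
  · subst hij
    rw [Equiv.swap_apply_left, ← mul_assoc, h1, mul_assoc, h4, add_comm]
  · by_cases hik : i = k
    · subst hik
      rw [Equiv.swap_apply_right, h2 j, ← mul_assoc, h1, mul_assoc, h4, add_comm]
    · rw [Equiv.swap_apply_of_ne_of_ne hij hik, ← mul_assoc, h2 i j, mul_assoc, h2 i k, mul_assoc]

theorem permOp_mul_exchPlus {N : ℕ} (τ a : ℂ) (w : Equiv.Perm (Fin N)) (j k : Fin N) :
    permOp w * exchPlus τ a j k = exchPlus τ a (w j) (w k) * permOp w := by
  rw [exchPlus, exchPlus, mul_smul_comm, smul_mul_assoc, mul_assoc _ (Kop _ _), ← permOp_mul_Kop,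
    ← mul_assoc, ← mul_assoc]
  simp only [mul_add, add_mul, mul_one, one_mul]
  rw [← mul_assoc, permOp_mul_twist, mul_assoc _ (permOp w), permOp_mul_twist]
  simp only [mul_assoc]

theorem permOp_mul_exchMinus {N : ℕ} (τ a : ℂ) (w : Equiv.Perm (Fin N)) (j k : Fin N) :
    permOp w * exchMinus τ a j k = exchMinus τ a (w j) (w k) * permOp w := by
  rw [exchMinus, exchMinus, mul_smul_comm, smul_mul_assoc, mul_assoc _ (Kop _ _), ← permOp_mul_Kop,
    ← mul_assoc, ← mul_assoc]
  simp only [mul_sub, sub_mul, mul_one, one_mul]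
  rw [← mul_assoc, permOp_mul_twist, mul_assoc _ (permOp w), permOp_mul_twist]
  simp only [mul_assoc]

theorem exchPlus_comm {N : ℕ} (τ a : ℂ) (j k : Fin N) : exchPlus τ a j k = exchPlus τ a k j := by
  rw [exchPlus, exchPlus, twist_comm, Kop_comm]

theorem exchMinus_comm {N : ℕ} (τ a : ℂ) (j k : Fin N) :
    exchMinus τ a j k = exchMinus τ a k j := by
  rw [exchMinus, exchMinus, twist_comm, Kop_comm]

theorem permOp_mul_commXop {N : ℕ} (τ a b : ℂ) (w : Equiv.Perm (Fin N)) (j k : Fin N) :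
    permOp w * commXop τ a b j k = commXop τ a b (w j) (w k) * permOp w := by
  simp only [commXop, w.injective.eq_iff]
  split_ifs
  · rw [mul_add, mul_add, add_mul, add_mul, mul_one, one_mul, mul_smul_comm, smul_mul_assoc,
      permOp_mul_twist, Finset.mul_sum, Finset.sum_mul]
    congr 2
    refine Finset.sum_equiv w (by simp) fun i _ => permOp_mul_exchPlus τ a w j i
  · rw [op_mul_neg, op_neg_mul, permOp_mul_exchMinus]

/-- Both sides kill `1` and have the same commutator with each coordinate, so the divided
differences need not be conjugated. -/
theorem permOp_mul_dunkl {N : ℕ} {τ b : ℂ} (h : IsType τ b) (a : ℂ) (w : Equiv.Perm (Fin N))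
    (j : Fin N) : permOp w * dunkl τ a b j = dunkl τ a b (w j) * permOp w := by
  apply op_eq (fun l => X (w l))
  · simp [dunkl_one_apply, permOp_one_apply]
  · intro l f
    have := LinearMap.congr_fun (permOp_mul_commXop τ a b w j l) f
    simp only [Module.End.mul_apply] at this ⊢
    rw [dunkl_X_mul h, permOp_X_mul, dunkl_X_mul h, map_add, permOp_X_mul, this]
    ring

/-- The sign is the one expected of a commutator: one factor from `∇_j` and one from `x_k`. It is
the input for `Top_mul_dunkl`. -/
theorem Top_mul_commXop {N : ℕ} (a b : ℂ) (i j k : Fin N) :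
    Top i * commXop 1 a b j k = (flipSign i j * flipSign i k) • (commXop 1 a b j k * Top i) := by
  have e : ∀ l : Fin N, Top l = twist 1 l := fun l => by simp [twist]
  have h1 : IsType 1 b := Or.inr rfl
  unfold commXop
  split_ifs with hjk
  · subst hjk
    rw [flipSign_mul_self, one_smul, e, mul_add, mul_add, add_mul, add_mul, mul_one, one_mul,
      Finset.mul_sum, Finset.sum_mul, mul_smul_comm, smul_mul_assoc, twist_comm 1 j i]
    simp only [twist_mul_exchPlus h1]
  · rw [op_mul_neg, op_neg_mul, smul_neg, exchMinus, mul_smul_comm, smul_mul_assoc, smul_comm _ a,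
      mul_assoc _ (Kop j k), e, Kop_mul_twist, ← mul_assoc, ← mul_assoc, ← smul_mul_assoc]
    congr 3
    have h2 := twist_mul_twist_mul_twist h1 (N := N)
    have h3 := twist_comm (N := N) 1
    have h4 := twist_mul_mul_twist_self h1 (N := N)
    rw [mul_sub, sub_mul, mul_one, one_mul, flipSign, flipSign]
    by_cases hij : i = j
    · subst hij
      rw [Equiv.swap_apply_left, ← mul_assoc, h2, mul_assoc, h4, if_pos rfl,
        if_neg (Ne.symm hjk)]
      refine LinearMap.ext fun f => ?_
      simp only [LinearMap.smul_apply, Module.End.mul_apply, LinearMap.sub_apply]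
      module
    · by_cases hik : i = k
      · subst hik
        rw [Equiv.swap_apply_right, h3 j, ← mul_assoc, h2, mul_assoc, h4, if_pos rfl, if_neg (Ne.symm hij)]
        refine LinearMap.ext fun f => ?_
        simp only [LinearMap.smul_apply, Module.End.mul_apply, LinearMap.sub_apply]
        module
      · rw [Equiv.swap_apply_of_ne_of_ne hij hik, ← mul_assoc, h3 i j, mul_assoc, h3 i k, mul_assoc,
          if_neg (Ne.symm hij), if_neg (Ne.symm hik)]
        simp

theorem Top_mul_dunkl {N : ℕ} (a b : ℂ) (i j : Fin N) :
    Top i * dunkl 1 a b j = flipSign i j • (dunkl 1 a b j * Top i) := by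
  have h : IsType 1 b := Or.inr rfl
  apply op_eq (fun l => flipSign i l • X l)
  · simp [dunkl_one_apply, Top_one_apply]
  · intro l f
    have := LinearMap.congr_fun (Top_mul_commXop a b i j l) f
    simp only [Module.End.mul_apply, LinearMap.smul_apply] at this ⊢
    rw [dunkl_X_mul h, map_add, this, Top_X_mul, Top_X_mul, map_smul, dunkl_X_mul h]
    simp only [smul_add, smul_smul, smul_mul_assoc, mul_sub, mul_smul_comm]
    abel

theorem twist_mul_dunkl_of_ne {N : ℕ} {τ b : ℂ} (h : IsType τ b) (a : ℂ) {i j : Fin N}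
    (hij : i ≠ j) : twist τ i * dunkl τ a b j = dunkl τ a b j * twist τ i := by
  rcases h with ⟨rfl, rfl⟩ | rfl
  · simp [twist]
  · simpa [twist, flipSign, hij.symm] using Top_mul_dunkl a b i j

theorem twist_mul_dunkl_self {N : ℕ} {τ b : ℂ} (h : IsType τ b) (a : ℂ) (j : Fin N) :
    twist τ j * dunkl τ a b j = -(dunkl τ a b j * twist τ j) := by
  rcases h with ⟨rfl, rfl⟩ | rfl
  · simp [twist]
  · have := Top_mul_dunkl a b j j
    rw [flipSign, if_pos rfl] at this
    simpa [twist] using this.trans (op_neg_one_smul _)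

theorem Kop_mul_dunkl {N : ℕ} {τ b : ℂ} (h : IsType τ b) (a : ℂ) (j k l : Fin N) :
    Kop j k * dunkl τ a b l = dunkl τ a b (Equiv.swap j k l) * Kop j k :=
  permOp_mul_dunkl h a _ l

theorem Kop_mul_Xop {N : ℕ} (j k l : Fin N) :
    Kop j k * Xop l = Xop (Equiv.swap j k l) * Kop j k :=
  LinearMap.ext fun f => permOp_X_mul _ l f

theorem twist_mul_Xop_of_ne {N : ℕ} (τ : ℂ) {i j : Fin N} (hij : i ≠ j) :
    twist τ i * Xop j = Xop j * twist τ i := by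
  refine LinearMap.ext fun f => ?_
  simp [twist, Xop, Top_X_mul, flipSign, hij.symm]

theorem twist_mul_Xop_self {N : ℕ} (τ : ℂ) (j : Fin N) :
    twist τ j * Xop j = -(Xop j * twist τ j) := by
  refine LinearMap.ext fun f => ?_
  simp [twist, Xop, Top_X_mul, flipSign]

theorem dunkl_mul_Xop {N : ℕ} {τ b : ℂ} (h : IsType τ b) (a : ℂ) (j k : Fin N) :
    dunkl τ a b j * Xop k = Xop k * dunkl τ a b j + commXop τ a b j k :=
  LinearMap.ext fun f => dunkl_X_mul h a j k f

/-! Relations for a family `D` on which permutations and sign changes act as on coordinates. -/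

/-- `K_{jk}` permutes the family `D`, and `τ t_j` changes the sign of `D_j` only. -/
structure IsEquivariant {N : ℕ} (τ : ℂ) (D : Fin N → Op N) : Prop where
  kop : ∀ j k l, Kop j k * D l = D (Equiv.swap j k l) * Kop j k
  twist_ne : ∀ i j, i ≠ j → twist τ i * D j = D j * twist τ i
  twist_self : ∀ j, twist τ j * D j = -(D j * twist τ j)

theorem isEquivariant_dunkl {N : ℕ} {τ b : ℂ} (h : IsType τ b) (a : ℂ) :
    IsEquivariant τ (dunkl (N := N) τ a b) :=
  ⟨Kop_mul_dunkl h a, fun _ _ => twist_mul_dunkl_of_ne h a, twist_mul_dunkl_self h a⟩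

theorem isEquivariant_creat {N : ℕ} {τ : ℂ} (ω : ℝ) {D : Fin N → Op N} (hD : IsEquivariant τ D) :
    IsEquivariant τ (fun j => creat ω (D j) j) where
  kop j k l := by
    simp only [creat, mul_sub, sub_mul, mul_smul_comm, smul_mul_assoc, hD.kop, Kop_mul_Xop]
  twist_ne i j hij := by
    simp only [creat, mul_sub, sub_mul, mul_smul_comm, smul_mul_assoc, hD.twist_ne i j hij,
      twist_mul_Xop_of_ne τ hij]
  twist_self j := by
    simp only [creat, mul_sub, sub_mul, mul_smul_comm, smul_mul_assoc, hD.twist_self j,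
      twist_mul_Xop_self, smul_neg, neg_sub]
    abel

theorem IsEquivariant.exchPlus_of_ne {N : ℕ} {τ : ℂ} {D : Fin N → Op N} (hD : IsEquivariant τ D)
    (a : ℂ) {j k l : Fin N} (hj : j ≠ l) (hk : k ≠ l) :
    exchPlus τ a j k * D l = D l * exchPlus τ a j k := by
  simp only [exchPlus, smul_mul_assoc, mul_smul_comm, mul_assoc, hD.kop,
    Equiv.swap_apply_of_ne_of_ne hj.symm hk.symm]
  congr 1
  simp only [← mul_assoc, add_mul, mul_add, one_mul]
  rw [mul_assoc (twist τ j), hD.twist_ne k l hk, ← mul_assoc, hD.twist_ne j l hj]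

theorem IsEquivariant.exchMinus_of_ne {N : ℕ} {τ : ℂ} {D : Fin N → Op N} (hD : IsEquivariant τ D)
    (a : ℂ) {j k l : Fin N} (hj : j ≠ l) (hk : k ≠ l) :
    exchMinus τ a j k * D l = D l * exchMinus τ a j k := by
  simp only [exchMinus, smul_mul_assoc, mul_smul_comm, mul_assoc, hD.kop,
    Equiv.swap_apply_of_ne_of_ne hj.symm hk.symm]
  congr 1
  simp only [← mul_assoc, sub_mul, mul_sub, one_mul]
  rw [mul_assoc (twist τ j), hD.twist_ne k l hk, ← mul_assoc, hD.twist_ne j l hj]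

/-- Moving `K_{jk}` past `D_k` produces `D_j`, whose sign is changed by `t_j` and not by `t_k`;
hence plus turns into minus. -/
theorem IsEquivariant.exchPlus_right {N : ℕ} {τ : ℂ} {D : Fin N → Op N} (hD : IsEquivariant τ D)
    (a : ℂ) {j k : Fin N} (h : j ≠ k) :
    exchPlus τ a j k * D k = D j * exchMinus τ a j k := by
  simp only [exchPlus, exchMinus, smul_mul_assoc, mul_smul_comm, mul_assoc, hD.kop,
    Equiv.swap_apply_right]
  congr 1
  simp only [← mul_assoc, add_mul, mul_sub, sub_mul, one_mul]
  rw [mul_assoc (twist τ j), hD.twist_ne k j h.symm, ← mul_assoc, hD.twist_self j]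
  simp only [op_neg_mul]
  abel

theorem IsEquivariant.exchMinus_right {N : ℕ} {τ : ℂ} {D : Fin N → Op N} (hD : IsEquivariant τ D)
    (a : ℂ) {j k : Fin N} (h : j ≠ k) :
    exchMinus τ a j k * D k = D j * exchPlus τ a j k := by
  simp only [exchPlus, exchMinus, smul_mul_assoc, mul_smul_comm, mul_assoc, hD.kop,
    Equiv.swap_apply_right]
  congr 1
  simp only [← mul_assoc, add_mul, mul_add, sub_mul, one_mul]
  rw [mul_assoc (twist τ j), hD.twist_ne k j h.symm, ← mul_assoc, hD.twist_self j]
  simp only [op_neg_mul]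
  abel

theorem IsEquivariant.exchMinus_left {N : ℕ} {τ : ℂ} {D : Fin N → Op N} (hD : IsEquivariant τ D)
    (a : ℂ) {j k : Fin N} (h : j ≠ k) :
    exchMinus τ a j k * D j = D k * exchPlus τ a j k := by
  rw [exchPlus_comm, exchMinus_comm, hD.exchMinus_right a h.symm]

theorem commXop_comm {N : ℕ} (τ a b : ℂ) (j k : Fin N) :
    commXop τ a b j k = commXop τ a b k j := by
  by_cases h : j = k
  · rw [h]
  · rw [commXop, commXop, if_neg h, if_neg (Ne.symm h), exchMinus_comm]

/-- By the Jacobi identity this says that `[∇_j, ∇_k]` commutes with every `x_l`, which is what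
`dunkl_comm` needs. -/
theorem commXop_jacobi {N : ℕ} {τ b : ℂ} (h : IsType τ b) (a : ℂ) {j k : Fin N} (hjk : j ≠ k)
    (l : Fin N) :
    commXop τ a b j l * dunkl τ a b k - dunkl τ a b k * commXop τ a b j l =
      commXop τ a b k l * dunkl τ a b j - dunkl τ a b j * commXop τ a b k l := by
  have hD := isEquivariant_dunkl (N := N) h a
  have key : ∀ {j k : Fin N}, j ≠ k →
      commXop τ a b j j * dunkl τ a b k - dunkl τ a b k * commXop τ a b j j =
        commXop τ a b k j * dunkl τ a b j - dunkl τ a b j * commXop τ a b k j := by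
    intro j k hjk
    -- Only the summand `l = k` involves the index of `∇_k`; all the others commute with it.
    have hsum : ∑ l ∈ Finset.univ.erase j, exchPlus τ a j l * dunkl τ a b k -
        ∑ l ∈ Finset.univ.erase j, dunkl τ a b k * exchPlus τ a j l =
        exchPlus τ a j k * dunkl τ a b k - dunkl τ a b k * exchPlus τ a j k := by
      rw [← Finset.sum_sub_distrib]
      refine Finset.sum_eq_single_of_mem k (by simp [hjk.symm]) fun l hl hlk => ?_
      rw [hD.exchPlus_of_ne a hjk hlk, sub_self]
    rw [commXop, if_pos rfl, commXop, if_neg hjk.symm]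
    simp only [add_mul, mul_add, one_mul, mul_one, smul_mul_assoc, mul_smul_comm, Finset.sum_mul,
      Finset.mul_sum, hD.twist_ne j k hjk]
    rw [op_neg_mul, op_mul_neg, exchMinus_comm τ a k j, hD.exchMinus_left a hjk,
      ← hD.exchPlus_right a hjk]
    rw [sub_eq_iff_eq_add] at hsum
    rw [hsum]
    abel
  by_cases hl : l = j
  · subst hl; exact key hjk
  · by_cases hl' : l = k
    · subst hl'; exact (key hjk.symm).symm
    · rw [commXop, commXop, if_neg (Ne.symm hl), if_neg (Ne.symm hl'), op_neg_mul, op_mul_neg, op_neg_mul,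
        op_mul_neg, hD.exchMinus_of_ne a hjk hl', hD.exchMinus_of_ne a hjk.symm hl, sub_self, sub_self]

theorem dunkl_comm {N : ℕ} {τ b : ℂ} (h : IsType τ b) (a : ℂ) (j k : Fin N) :
    dunkl τ a b j * dunkl τ a b k = dunkl τ a b k * dunkl τ a b j := by
  by_cases hjk : j = k
  · rw [hjk]
  apply op_eq (fun l => X l)
  · simp [dunkl_one_apply]
  · intro l f
    have := LinearMap.congr_fun (commXop_jacobi h a hjk l) f
    simp only [Module.End.mul_apply, LinearMap.sub_apply] at this ⊢
    simp only [dunkl_X_mul h, map_add]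
    linear_combination this

theorem dunkl_mul_creat {N : ℕ} {τ b : ℂ} (h : IsType τ b) (a : ℂ) (ω : ℝ) {j k : Fin N}
    (hjk : j ≠ k) : dunkl τ a b j * creat ω (dunkl τ a b k) k =
      creat ω (dunkl τ a b k) k * dunkl τ a b j - exchMinus τ a j k := by
  rw [creat, mul_sub, sub_mul, dunkl_mul_Xop h, mul_smul_comm, smul_mul_assoc, dunkl_comm h,
    commXop, if_neg hjk]
  abel

/-- The coordinates commute, the Dunkl operators commute, and the cross terms cancel because `[∇_j,
x_k]` is symmetric in `j` and `k`. -/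
theorem creat_comm {N : ℕ} {τ b : ℂ} (h : IsType τ b) (a : ℂ) (ω : ℝ) (j k : Fin N) :
    creat ω (dunkl τ a b j) j * creat ω (dunkl τ a b k) k =
      creat ω (dunkl τ a b k) k * creat ω (dunkl τ a b j) j := by
  have hX : Xop j * Xop k = Xop k * (Xop j : Op N) :=
    LinearMap.ext fun f => mul_left_comm (X j) (X k) f
  simp only [creat, mul_sub, sub_mul, mul_smul_comm, smul_mul_assoc, dunkl_mul_Xop h,
    dunkl_comm h a k j, commXop_comm τ a b k j, hX, smul_add]
  simp only [smul_sub]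
  abel

/-! ### The Cherednik operators of both types -/

/-- The Cherednik operator `d_j`; `τ = 0`, `b = 0` is type `A` and `τ = 1` is type `B`. -/
def cherednik {N : ℕ} (τ a b : ℂ) (ω : ℝ) (j : Fin N) : Op N :=
  creat ω (dunkl τ a b j) j * dunkl τ a b j + ∑ k ∈ Finset.Ioi j, exchPlus τ a j k
    + b • twist τ j

theorem creat_mul_annih {N : ℕ} {ω : ℝ} (hω : 0 < ω) (D : Op N) (j : Fin N) :
    (2 * ω : ℂ) • (creat ω D j * annih ω D) = creat ω D j * D := by
  have : (2 * ω : ℂ) ≠ 0 := by exact_mod_cast (by positivity : (2 * ω : ℝ) ≠ 0)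
  rw [annih, mul_smul_comm, smul_smul, mul_one_div_cancel this, one_smul]

theorem cherednikA_eq {N : ℕ} {ω : ℝ} (hω : 0 < ω) (a : ℝ) :
    cherednikA (N := N) a ω = cherednik 0 a 0 ω := by
  funext j
  rw [cherednikA, cherednik, creat_mul_annih hω, dunklA_eq, zero_smul, add_zero, Finset.smul_sum]
  simp only [exchPlus, twist, zero_smul, zero_mul, add_zero, one_mul]

theorem cherednikB_eq {N : ℕ} {ω : ℝ} (hω : 0 < ω) (a b : ℝ) :
    cherednikB (N := N) a b ω = cherednik 1 a b ω := by
  funext j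
  rw [cherednikB, cherednik, creat_mul_annih hω, dunklB_eq, Finset.smul_sum]
  simp only [exchPlus, twist, one_smul]

theorem twist_mul_cherednik {N : ℕ} {τ b : ℂ} (h : IsType τ b) (a : ℂ) (ω : ℝ) (i j : Fin N) :
    twist τ i * cherednik τ a b ω j = cherednik τ a b ω j * twist τ i := by
  have hD := isEquivariant_dunkl (N := N) h a
  have hy := isEquivariant_creat ω hD
  simp only [cherednik, mul_add, add_mul, Finset.mul_sum, Finset.sum_mul, mul_smul_comm,
    smul_mul_assoc, twist_mul_exchPlus h, twist_comm τ j i]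
  congr 2
  by_cases hij : i = j
  · subst hij
    rw [← mul_assoc, hy.twist_self, op_neg_mul, mul_assoc, hD.twist_self, op_mul_neg, neg_neg, mul_assoc]
  · rw [← mul_assoc, hy.twist_ne i j hij, mul_assoc, hD.twist_ne i j hij, mul_assoc]

/-- Since `k` and `l` both exceed `j`, their exchange only permutes the summands; each twist
commutes with every summand. -/
theorem sum_exchPlus_mul_exchPlus {N : ℕ} {τ b : ℂ} (h : IsType τ b) (a : ℂ) {j k l : Fin N}
    (hk : j < k) (hl : j < l) :
    (∑ i ∈ Finset.Ioi j, exchPlus τ a j i) * exchPlus τ a k l =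
      exchPlus τ a k l * ∑ i ∈ Finset.Ioi j, exchPlus τ a j i := by
  have h1 : Kop k l * (∑ i ∈ Finset.Ioi j, exchPlus τ a j i) =
      (∑ i ∈ Finset.Ioi j, exchPlus τ a j i) * Kop k l := by
    rw [Finset.mul_sum, Finset.sum_mul]
    refine Finset.sum_equiv (Equiv.swap k l) (fun i => ?_) fun i _ => ?_
    · simp only [Finset.mem_Ioi, Equiv.swap_apply_def]
      split_ifs with h1 h2 <;> simp_all
    · rw [Kop_eq_permOp, permOp_mul_exchPlus, Equiv.swap_apply_of_ne_of_ne hk.ne hl.ne]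
  have h2 : ∀ m, twist τ m * (∑ i ∈ Finset.Ioi j, exchPlus τ a j i) =
      (∑ i ∈ Finset.Ioi j, exchPlus τ a j i) * twist τ m := fun m => by
    simp only [Finset.mul_sum, Finset.sum_mul, twist_mul_exchPlus h]
  generalize (∑ i ∈ Finset.Ioi j, exchPlus τ a j i) = S at *
  rw [exchPlus, mul_smul_comm, smul_mul_assoc, mul_assoc, h1]
  simp only [← mul_assoc, mul_add, add_mul, one_mul]
  rw [mul_assoc (twist τ k), h2 l, ← mul_assoc, h2 k]

theorem cherednik_comm {N : ℕ} {τ b : ℂ} (h : IsType τ b) (a : ℂ) (ω : ℝ) (j k : Fin N) :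
    cherednik τ a b ω j * cherednik τ a b ω k = cherednik τ a b ω k * cherednik τ a b ω j := by
  wlog hjk : j < k generalizing j k
  · rcases (not_lt.1 hjk).lt_or_eq with h1 | rfl
    · exact (this k j h1).symm
    · rfl
  have hD := isEquivariant_dunkl (N := N) h a
  have hy := isEquivariant_creat ω hD
  have hT := twist_mul_cherednik (N := N) h a ω
  have hE : ∀ i l m : Fin N, i ≠ l → i ≠ m →
      Commute (exchPlus τ a l m) (creat ω (dunkl τ a b i) i * dunkl τ a b i) := fun i l m hl hm => by
    rw [commute_iff_eq, ← mul_assoc, hy.exchPlus_of_ne a hl.symm hm.symm, mul_assoc,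
      hD.exchPlus_of_ne a hl.symm hm.symm, mul_assoc]
  have hG : (∑ i ∈ Finset.Ioi j, exchPlus τ a j i) * (∑ i ∈ Finset.Ioi k, exchPlus τ a k i) =
      (∑ i ∈ Finset.Ioi k, exchPlus τ a k i) * (∑ i ∈ Finset.Ioi j, exchPlus τ a j i) := by
    rw [Finset.mul_sum, Finset.sum_mul]
    refine Finset.sum_congr rfl fun l hl => ?_
    exact sum_exchPlus_mul_exchPlus h a hjk (hjk.trans (Finset.mem_Ioi.1 hl))
  have h1 : (creat ω (dunkl τ a b j) j * dunkl τ a b j) * (∑ i ∈ Finset.Ioi k, exchPlus τ a k i) =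
      (∑ i ∈ Finset.Ioi k, exchPlus τ a k i) * (creat ω (dunkl τ a b j) j * dunkl τ a b j) := by
    rw [Finset.mul_sum, Finset.sum_mul]
    refine Finset.sum_congr rfl fun l hl => ?_
    exact (hE j k l hjk.ne (hjk.trans (Finset.mem_Ioi.1 hl)).ne).eq.symm
  -- The first-order parts do not commute with one another. Their commutator is cancelled by that of
  -- the single exchange term with `i = k` in the sum over `i > j`.
  have h2 : (creat ω (dunkl τ a b j) j * dunkl τ a b j) * (creat ω (dunkl τ a b k) k * dunkl τ a b k)
      + (∑ i ∈ Finset.Ioi j, exchPlus τ a j i) * (creat ω (dunkl τ a b k) k * dunkl τ a b k) =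
      (creat ω (dunkl τ a b k) k * dunkl τ a b k) * (creat ω (dunkl τ a b j) j * dunkl τ a b j) +
      (creat ω (dunkl τ a b k) k * dunkl τ a b k) * (∑ i ∈ Finset.Ioi j, exchPlus τ a j i) := by
    have h3 : (∑ i ∈ Finset.Ioi j, exchPlus τ a j i) * (creat ω (dunkl τ a b k) k * dunkl τ a b k) -
        (creat ω (dunkl τ a b k) k * dunkl τ a b k) * (∑ i ∈ Finset.Ioi j, exchPlus τ a j i) =
        exchPlus τ a j k * (creat ω (dunkl τ a b k) k * dunkl τ a b k) -
        (creat ω (dunkl τ a b k) k * dunkl τ a b k) * exchPlus τ a j k := by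
      rw [Finset.mul_sum, Finset.sum_mul, ← Finset.sum_sub_distrib]
      refine Finset.sum_eq_single_of_mem k (Finset.mem_Ioi.2 hjk) fun l hl hlk => ?_
      rw [(hE k j l hjk.ne' hlk.symm).eq, sub_self]
    have h4 : exchPlus τ a j k * (creat ω (dunkl τ a b k) k * dunkl τ a b k) =
        creat ω (dunkl τ a b j) j * (exchMinus τ a j k * dunkl τ a b k) := by
      rw [← mul_assoc, hy.exchPlus_right a hjk.ne, mul_assoc]
    have h5 : (creat ω (dunkl τ a b k) k * dunkl τ a b k) * exchPlus τ a j k =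
        creat ω (dunkl τ a b k) k * (exchMinus τ a j k * dunkl τ a b j) := by
      rw [hD.exchMinus_left a hjk.ne, mul_assoc]
    have h6 : (creat ω (dunkl τ a b j) j * dunkl τ a b j) *
        (creat ω (dunkl τ a b k) k * dunkl τ a b k) =
        creat ω (dunkl τ a b j) j * creat ω (dunkl τ a b k) k * (dunkl τ a b j * dunkl τ a b k) -
          creat ω (dunkl τ a b j) j * (exchMinus τ a j k * dunkl τ a b k) := by
      rw [mul_assoc, ← mul_assoc (dunkl τ a b j), dunkl_mul_creat h a ω hjk.ne, sub_mul, mul_sub]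
      simp only [mul_assoc]
    have h7 : (creat ω (dunkl τ a b k) k * dunkl τ a b k) *
        (creat ω (dunkl τ a b j) j * dunkl τ a b j) =
        creat ω (dunkl τ a b j) j * creat ω (dunkl τ a b k) k * (dunkl τ a b j * dunkl τ a b k) -
          creat ω (dunkl τ a b k) k * (exchMinus τ a j k * dunkl τ a b j) := by
      rw [mul_assoc, ← mul_assoc (dunkl τ a b k), dunkl_mul_creat h a ω hjk.ne', sub_mul, mul_sub,
        creat_comm h a ω j k, dunkl_comm h a j k, exchMinus_comm τ a k j]
      simp only [mul_assoc]
    rw [h4, h5] at h3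
    rw [h6, h7]
    rw [sub_eq_iff_eq_add] at h3
    rw [h3]
    abel
  -- Twists commute with the whole `d_k`; removing its summand `b • twist τ k`, which also commutes
  -- with them, leaves this.
  have h8 : twist τ j * (creat ω (dunkl τ a b k) k * dunkl τ a b k +
      ∑ i ∈ Finset.Ioi k, exchPlus τ a k i) = (creat ω (dunkl τ a b k) k * dunkl τ a b k +
      ∑ i ∈ Finset.Ioi k, exchPlus τ a k i) * twist τ j := by
    have := hT j k
    rw [cherednik, mul_add, add_mul, mul_smul_comm, smul_mul_assoc, twist_comm τ j k] at this
    exact add_right_cancel this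
  have h9 : twist τ k * (creat ω (dunkl τ a b j) j * dunkl τ a b j +
      ∑ i ∈ Finset.Ioi j, exchPlus τ a j i) = (creat ω (dunkl τ a b j) j * dunkl τ a b j +
      ∑ i ∈ Finset.Ioi j, exchPlus τ a j i) * twist τ k := by
    have := hT k j
    rw [cherednik, mul_add, add_mul, mul_smul_comm, smul_mul_assoc, twist_comm τ k j] at this
    exact add_right_cancel this
  simp only [cherednik]
  generalize creat ω (dunkl τ a b j) j * dunkl τ a b j = A at *
  generalize creat ω (dunkl τ a b k) k * dunkl τ a b k = B at *
  generalize ∑ i ∈ Finset.Ioi j, exchPlus τ a j i = G at *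
  generalize ∑ i ∈ Finset.Ioi k, exchPlus τ a k i = H at *
  have h10 : (A + G) * (B + H) = (B + H) * (A + G) := by
    rw [add_mul, mul_add, mul_add, add_mul, mul_add, mul_add, h1, hG]
    have : A * B + H * A + (G * B + H * G) = (A * B + G * B) + (H * A + H * G) := by abel
    rw [this, h2]
  rw [add_mul, mul_add (A + G), h10, add_mul (B + H), mul_add (B + H), smul_mul_assoc,
    mul_add (twist τ j), h8, mul_smul_comm, ← h9]
  simp only [mul_smul_comm, smul_mul_assoc, mul_add, smul_add, twist_comm τ k j]
  abel

theorem lo_ne_hi {N : ℕ} (j : Fin (N - 1)) : lo j ≠ hi j := by simp [lo, hi, Fin.ext_iff]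

theorem lo_lt_hi {N : ℕ} (j : Fin (N - 1)) : lo j < hi j := by simp [lo, hi, Fin.lt_def]

theorem Ioi_lo {N : ℕ} (j : Fin (N - 1)) :
    Finset.Ioi (lo j) = insert (hi j) (Finset.Ioi (hi j)) := by
  ext k
  simp only [Finset.mem_Ioi, Finset.mem_insert, lo, hi, Fin.lt_def, Fin.ext_iff]
  omega

/-- Adjacency of the exchanged indices matters: it makes the range `k > i` of the ordered sum stable
under the exchange. -/
theorem Kop_mul_cherednik_of_ne {N : ℕ} {τ b : ℂ} (h : IsType τ b) (a : ℂ) (ω : ℝ)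
    (j : Fin (N - 1)) {i : Fin N} (h1 : i ≠ lo j) (h2 : i ≠ hi j) :
    Kop (lo j) (hi j) * cherednik τ a b ω i = cherednik τ a b ω i * Kop (lo j) (hi j) := by
  have hD := isEquivariant_dunkl (N := N) h a
  have hy := isEquivariant_creat ω hD
  have hi' := Equiv.swap_apply_of_ne_of_ne h1 h2
  simp only [cherednik, mul_add, add_mul, mul_smul_comm, smul_mul_assoc, Kop_mul_twist, hi']
  congr 2
  · rw [← mul_assoc, hy.kop, mul_assoc, hD.kop, hi', mul_assoc]
  · rw [Finset.mul_sum, Finset.sum_mul]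
    refine Finset.sum_equiv (Equiv.swap (lo j) (hi j)) (fun k => ?_) fun k _ => ?_
    · simp only [Finset.mem_Ioi, Equiv.swap_apply_def]
      simp only [lo, hi, Fin.lt_def, Fin.ext_iff, ne_eq] at h1 h2 ⊢
      split_ifs <;> simp only <;> omega
    · rw [Kop_eq_permOp, permOp_mul_exchPlus, hi']

/-- The range `k > j` has one index more than `k > j + 1`. The corresponding term contains
`K_{j,j+1}`, which squares to `1` and leaves the inhomogeneous part. -/
theorem Kop_mul_cherednik_lo {N : ℕ} {τ b : ℂ} (h : IsType τ b) (a : ℂ) (ω : ℝ)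
    (j : Fin (N - 1)) :
    Kop (lo j) (hi j) * cherednik τ a b ω (lo j) =
      cherednik τ a b ω (hi j) * Kop (lo j) (hi j) +
        a • (1 + twist τ (lo j) * twist τ (hi j)) := by
  have hD := isEquivariant_dunkl (N := N) h a
  have hy := isEquivariant_creat ω hD
  have hs := Equiv.swap_apply_left (lo j) (hi j)
  have hE : Kop (lo j) (hi j) * ∑ k ∈ Finset.Ioi (lo j), exchPlus τ a (lo j) k =
      a • (1 + twist τ (lo j) * twist τ (hi j)) +
        (∑ k ∈ Finset.Ioi (hi j), exchPlus τ a (hi j) k) * Kop (lo j) (hi j) := by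
    rw [Ioi_lo, Finset.sum_insert (by simp), mul_add, Finset.mul_sum, Finset.sum_mul]
    congr 1
    · rw [Kop_eq_permOp, permOp_mul_exchPlus, ← Kop_eq_permOp, Equiv.swap_apply_right, hs,
        exchPlus_comm, exchPlus, smul_mul_assoc, mul_assoc, Kop_mul_self, mul_one]
    · refine Finset.sum_congr rfl fun k hk => ?_
      have hk' := Finset.mem_Ioi.1 hk
      rw [Kop_eq_permOp, permOp_mul_exchPlus, hs,
        Equiv.swap_apply_of_ne_of_ne ((lo_lt_hi j).trans hk').ne' hk'.ne']
  simp only [cherednik, mul_add, add_mul, mul_smul_comm, smul_mul_assoc, Kop_mul_twist, hs, hE]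
  rw [← mul_assoc, hy.kop, mul_assoc, hD.kop, hs, mul_assoc]
  abel

theorem Kop_mul_cherednik_hi {N : ℕ} {τ b : ℂ} (h : IsType τ b) (a : ℂ) (ω : ℝ)
    (j : Fin (N - 1)) :
    Kop (lo j) (hi j) * cherednik τ a b ω (hi j) +
        a • (1 + twist τ (lo j) * twist τ (hi j)) =
      cherednik τ a b ω (lo j) * Kop (lo j) (hi j) := by
  have h1 := congrArg (fun A => Kop (lo j) (hi j) * A * Kop (lo j) (hi j))
    (Kop_mul_cherednik_lo h a ω j)
  simp only [← mul_assoc, Kop_mul_self, one_mul, mul_add, add_mul] at h1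
  rw [h1, mul_assoc _ (Kop _ _) (Kop _ _), Kop_mul_self, mul_one]
  congr 1
  have h2 : Kop (lo j) (hi j) * (twist τ (lo j) * twist τ (hi j)) =
      twist τ (lo j) * twist τ (hi j) * Kop (lo j) (hi j) := by
    rw [← mul_assoc, Kop_mul_twist, mul_assoc, Kop_mul_twist, ← mul_assoc, Equiv.swap_apply_left,
      Equiv.swap_apply_right, twist_comm]
  rw [mul_smul_comm, smul_mul_assoc, mul_add, h2, mul_one, add_mul, mul_assoc _ _ (Kop _ _),
    Kop_mul_self, mul_one]

/-! ### Inversions and sorting permutations -/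

theorem perm_inv_apply_self {N : ℕ} (w : Equiv.Perm (Fin N)) (i : Fin N) : w⁻¹ (w i) = i :=
  w.symm_apply_apply i

theorem perm_apply_inv_self {N : ℕ} (w : Equiv.Perm (Fin N)) (i : Fin N) : w (w⁻¹ i) = i :=
  w.apply_symm_apply i

theorem eps_sub_eps_inj {N : ℕ} {i k i' k' : Fin N} (h : i ≠ k)
    (e : (eps i - eps k : Fin N → ℝ) = eps i' - eps k') : i = i' ∧ k = k' := by
  have h1 := congrFun e i
  have h2 := congrFun e k
  simp only [eps, Pi.sub_apply, Pi.single_apply, if_true, if_neg h, if_neg h.symm] at h1 h2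
  constructor
  · by_contra hc
    rw [if_neg hc] at h1
    split_ifs at h1 <;> norm_num at h1
  · by_contra hc
    rw [if_neg hc] at h2
    split_ifs at h2 <;> norm_num at h2

theorem act_eps {N : ℕ} (w : Equiv.Perm (Fin N)) (j : Fin N) : act w (eps j) = eps (w j) := by
  funext i
  simp [act, eps, Pi.single_apply, Equiv.symm_apply_eq]

theorem act_eps_sub {N : ℕ} (w : Equiv.Perm (Fin N)) (j k : Fin N) :
    act w (eps j - eps k) = eps (w j) - eps (w k) := by
  rw [← act_eps, ← act_eps]; rfl

theorem mem_posRoots {N : ℕ} {i k : Fin N} (h : i ≠ k) :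
    (eps i - eps k : Fin N → ℝ) ∈ posRoots N ↔ i < k := by
  simp only [posRoots, Finset.mem_image, Finset.mem_filter, Finset.mem_univ, true_and,
    Prod.exists]
  constructor
  · rintro ⟨i', k', hlt, e⟩
    obtain ⟨rfl, rfl⟩ := eps_sub_eps_inj h e.symm
    exact hlt
  · exact fun hlt => ⟨i, k, hlt, rfl⟩

/-- The pairs of positions inverted by `w`. -/
def posInv {N : ℕ} (w : Equiv.Perm (Fin N)) : Finset (Fin N × Fin N) :=
  Finset.univ.filter fun p => p.1 < p.2 ∧ w p.2 < w p.1

theorem mem_posInv {N : ℕ} {w : Equiv.Perm (Fin N)} {i k : Fin N} :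
    (i, k) ∈ posInv w ↔ i < k ∧ w k < w i := by simp [posInv]

/-- The pairs of values inverted by `w`. -/
def valInv {N : ℕ} (w : Equiv.Perm (Fin N)) : Finset (Fin N × Fin N) :=
  Finset.univ.filter fun p => p.1 < p.2 ∧ w⁻¹ p.2 < w⁻¹ p.1

open Classical in
theorem inversions_eq {N : ℕ} (w : Equiv.Perm (Fin N)) :
    inversions w = (posInv w).image fun p => eps p.1 - eps p.2 := by
  ext α
  simp only [inversions, posInv, Finset.mem_filter, Finset.mem_image, Finset.mem_univ, true_and,
    Prod.exists]
  constructor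
  · rintro ⟨h1, h2⟩
    simp only [posRoots, Finset.mem_image, Finset.mem_filter, Finset.mem_univ, true_and,
      Prod.exists] at h1
    obtain ⟨i, k, hlt, rfl⟩ := h1
    rw [act_eps_sub, neg_sub, mem_posRoots (w.injective.ne hlt.ne')] at h2
    exact ⟨i, k, ⟨hlt, h2⟩, rfl⟩
  · rintro ⟨i, k, ⟨h1, h2⟩, rfl⟩
    rw [act_eps_sub, neg_sub, mem_posRoots h2.ne, mem_posRoots h1.ne]
    exact ⟨h1, h2⟩

theorem injOn_posInv {N : ℕ} (w : Equiv.Perm (Fin N)) :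
    Set.InjOn (fun p : Fin N × Fin N => (eps p.1 - eps p.2 : Fin N → ℝ)) (posInv w) := by
  rintro ⟨i, k⟩ h ⟨i', k'⟩ - e
  simp only [posInv, Finset.coe_filter, Finset.mem_univ, true_and, Set.mem_ofPred_eq] at h
  obtain ⟨rfl, rfl⟩ := eps_sub_eps_inj h.1.ne e
  rfl

theorem prod_inversions {N : ℕ} (w : Equiv.Perm (Fin N)) (f : (Fin N → ℝ) → ℝ) :
    ∏ α ∈ inversions w, f α = ∏ p ∈ posInv w, f (eps p.1 - eps p.2) := by
  rw [inversions_eq, Finset.prod_image (injOn_posInv w)]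

theorem length_eq_card_posInv {N : ℕ} (w : Equiv.Perm (Fin N)) : length w = (posInv w).card := by
  rw [length, inversions_eq, Finset.card_image_of_injOn (injOn_posInv w)]

theorem length_eq_card_valInv {N : ℕ} (w : Equiv.Perm (Fin N)) : length w = (valInv w).card := by
  rw [length_eq_card_posInv]
  refine Finset.card_equiv ((Equiv.prodComm _ _).trans (w.prodCongr w)) fun p => ?_
  simp [posInv, valInv, and_comm]

theorem simpleRefl_lt_iff {N : ℕ} (j : Fin (N - 1)) {p q : Fin N}
    (h1 : ¬(p = lo j ∧ q = hi j)) (h2 : ¬(p = hi j ∧ q = lo j)) :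
    simpleRefl j p < simpleRefl j q ↔ p < q := by
  simp only [simpleRefl, Equiv.swap_apply_def]
  simp only [lo, hi, Fin.lt_def, Fin.ext_iff] at h1 h2 ⊢
  split_ifs <;> simp only <;> omega

/-- An adjacent transposition of values preserves the order of every pair of values except the
transposed one, so exactly one inversion is added. -/
theorem posInv_simpleRefl_mul {N : ℕ} (j : Fin (N - 1)) (w : Equiv.Perm (Fin N))
    (h : w⁻¹ (lo j) < w⁻¹ (hi j)) :
    posInv (simpleRefl j * w) = insert (w⁻¹ (lo j), w⁻¹ (hi j)) (posInv w) := by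
  ext ⟨i, k⟩
  simp only [mem_posInv, Finset.mem_insert, Prod.mk.injEq, Equiv.Perm.mul_apply]
  by_cases h1 : w i = lo j ∧ w k = hi j
  · obtain ⟨h1, h2⟩ := h1
    rw [← h1, ← h2] at h
    simp only [perm_inv_apply_self] at h
    have h3 : simpleRefl j (w k) < simpleRefl j (w i) := by
      rw [h1, h2, simpleRefl, Equiv.swap_apply_left, Equiv.swap_apply_right]
      exact lo_lt_hi j
    simp only [← h1, ← h2, h, h3, perm_inv_apply_self, and_self, true_or]
  · by_cases h2 : w i = hi j ∧ w k = lo j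
    · obtain ⟨h2, h3⟩ := h2
      rw [← h2, ← h3] at h ⊢
      simp only [perm_inv_apply_self] at h ⊢
      have := h.ne
      have := h.not_gt
      tauto
    · rw [simpleRefl_lt_iff j (fun h => h2 h.symm) (fun h => h1 h.symm)]
      have : ¬(i = w⁻¹ (lo j) ∧ k = w⁻¹ (hi j)) := fun h => h1 (by simp [h.1, h.2])
      tauto

theorem notMem_posInv {N : ℕ} (j : Fin (N - 1)) (w : Equiv.Perm (Fin N)) :
    (w⁻¹ (lo j), w⁻¹ (hi j)) ∉ posInv w := by
  simp [posInv, (lo_lt_hi j).not_gt]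

theorem length_simpleRefl_mul {N : ℕ} (j : Fin (N - 1)) (w : Equiv.Perm (Fin N))
    (h : w⁻¹ (lo j) < w⁻¹ (hi j)) : length (simpleRefl j * w) = length w + 1 := by
  rw [length_eq_card_posInv, posInv_simpleRefl_mul j w h, Finset.card_insert_of_notMem
    (notMem_posInv j w), length_eq_card_posInv]

theorem simpleRefl_mul_self {N : ℕ} (j : Fin (N - 1)) : simpleRefl j * simpleRefl j = 1 :=
  Equiv.swap_mul_self _ _

theorem length_simpleRefl_mul_le {N : ℕ} (j : Fin (N - 1)) (w : Equiv.Perm (Fin N)) :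
    length (simpleRefl j * w) ≤ length w + 1 := by
  by_cases h : w⁻¹ (lo j) < w⁻¹ (hi j)
  · exact (length_simpleRefl_mul j w h).le
  · have h' : w⁻¹ (hi j) < w⁻¹ (lo j) :=
      lt_of_le_of_ne (not_lt.1 h) (w⁻¹.injective.ne (lo_ne_hi j).symm)
    have := length_simpleRefl_mul j (simpleRefl j * w) (by simpa [simpleRefl] using h')
    rw [← mul_assoc, simpleRefl_mul_self, one_mul] at this
    omega

theorem length_one {N : ℕ} : length (1 : Equiv.Perm (Fin N)) = 0 := by
  rw [length_eq_card_posInv, Finset.card_eq_zero, posInv, Finset.filter_eq_empty_iff]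
  rintro p - ⟨h1, h2⟩
  exact h1.not_gt h2

theorem length_prod_le {N : ℕ} (js : List (Fin (N - 1))) :
    length (js.map simpleRefl).prod ≤ js.length := by
  induction js with
  | nil => simp [length_one]
  | cons j js ih =>
    simp only [List.map_cons, List.prod_cons, List.length_cons]
    exact (length_simpleRefl_mul_le _ _).trans (by omega)

/-- The tail of a reduced word is reduced, and its head creates an inversion. -/
theorem IsReducedWord.tail {N : ℕ} {w : Equiv.Perm (Fin N)} {j : Fin (N - 1)}
    {js : List (Fin (N - 1))} (h : IsReducedWord w (j :: js)) :
    IsReducedWord (simpleRefl j * w) js ∧ w⁻¹ (hi j) < w⁻¹ (lo j) := by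
  obtain ⟨h1, h2⟩ := h
  simp only [List.map_cons, List.prod_cons, List.length_cons] at h1 h2
  have h3 := length_prod_le js
  have h4 := length_simpleRefl_mul_le j (js.map simpleRefl).prod
  have h5 : (js.map simpleRefl).prod = simpleRefl j * w := by
    rw [← h1, ← mul_assoc, simpleRefl_mul_self, one_mul]
  rw [h1] at h4
  refine ⟨⟨h5, by rw [← h5]; omega⟩, ?_⟩
  refine lt_of_le_of_ne (not_lt.1 fun hlt => ?_) (w⁻¹.injective.ne (lo_ne_hi j).symm)
  have := length_simpleRefl_mul j w hlt
  rw [← h5] at this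
  omega

/-- `w` sorts `μ` into decreasing order, keeping the order of equal entries. -/
def IsSort {N : ℕ} (μ : Comp N) (w : Equiv.Perm (Fin N)) : Prop :=
  ∀ p q, w⁻¹ p < w⁻¹ q ↔ μ q < μ p ∨ (μ p = μ q ∧ p < q)

theorem exists_isSort {N : ℕ} (μ : Comp N) : ∃ w, IsSort μ w := by
  obtain ⟨h1, h2⟩ := Tuple.eq_sort_iff.1
    (rfl : Tuple.sort (fun i => OrderDual.toDual (μ i)) = _)
  set w := Tuple.sort fun i => OrderDual.toDual (μ i)
  have key : ∀ i j, i < j → μ (w j) < μ (w i) ∨ (μ (w i) = μ (w j) ∧ w i < w j) := by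
    intro i j hij
    have h3 : μ (w j) ≤ μ (w i) := h1 hij.le
    rcases h3.lt_or_eq with h | h
    · exact Or.inl h
    · exact Or.inr ⟨h.symm, h2 i j hij (congrArg OrderDual.toDual h.symm)⟩
  refine ⟨w, fun p q => ⟨fun h => by simpa using key _ _ h, fun h => ?_⟩⟩
  by_contra hc
  rcases (not_lt.1 hc).lt_or_eq with h3 | h3
  · have := key _ _ h3
    simp only [perm_apply_inv_self] at this
    omega
  · have := w⁻¹.injective h3
    subst this
    simp at h

theorem Comp.act_apply {N : ℕ} (w : Equiv.Perm (Fin N)) (μ : Comp N) (i : Fin N) :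
    Comp.act w μ i = μ (w⁻¹ i) := rfl

/-- A value pair inverted by the stable sort has strictly increasing entries, so every sorting
permutation must invert it. Minimal length then forces the two inversion sets to coincide, and these
determine the order of the positions. -/
theorem isSort_shortest {N : ℕ} (μ : Comp N) : IsSort μ (shortest μ) := by
  obtain ⟨w₀, h₀⟩ := exists_isSort μ
  obtain ⟨hw, hmin⟩ := (exists_shortest μ).choose_spec
  change (Comp.act (shortest μ)⁻¹ μ).IsPartition at hw
  have hsort : (Comp.act w₀⁻¹ μ).IsPartition := by
    intro i j hij
    simp only [Comp.act_apply, inv_inv]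
    rcases hij.lt_or_eq with h | h
    · have := (h₀ (w₀ i) (w₀ j)).1 (by simpa using h)
      omega
    · rw [h]
  have hlen : length (shortest μ) ≤ length w₀ := hmin w₀ hsort
  have hpart : ∀ p q, (shortest μ)⁻¹ p ≤ (shortest μ)⁻¹ q → μ q ≤ μ p := fun p q h => by
    simpa [Comp.act_apply] using hw h
  have hsub : valInv w₀ ⊆ valInv (shortest μ) := by
    rintro ⟨p, q⟩ hpq
    simp only [valInv, Finset.mem_filter, Finset.mem_univ, true_and] at hpq ⊢
    refine ⟨hpq.1, not_le.1 fun hle => ?_⟩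
    have h1 := hpart _ _ hle
    have h2 := (h₀ _ _).1 hpq.2
    have h3 := hpq.1
    omega
  rw [length_eq_card_valInv, length_eq_card_valInv] at hlen
  have heq := Finset.eq_of_subset_of_card_le hsub hlen
  have key : ∀ p q, p < q → ((shortest μ)⁻¹ q < (shortest μ)⁻¹ p ↔ μ p < μ q) := by
    intro p q hpq
    have h1 : (p, q) ∈ valInv w₀ ↔ (p, q) ∈ valInv (shortest μ) := by rw [heq]
    simp only [valInv, Finset.mem_filter, Finset.mem_univ, true_and, hpq] at h1
    rw [← h1, h₀]
    omega
  intro p q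
  rcases lt_trichotomy p q with h | h | h
  · have h1 := key p q h
    have h2 : (shortest μ)⁻¹ p ≠ (shortest μ)⁻¹ q := (shortest μ)⁻¹.injective.ne h.ne
    omega
  · subst h; simp
  · have h1 := key q p h
    omega

/-! ### Ranks, `ρ(μ)` and the separation of spectra -/

/-- The number of entries of `μ` that come after the `j`-th one in decreasing order. -/
def rankAfter {N : ℕ} (μ : Comp N) (j : Fin N) : ℕ :=
  (Finset.univ.filter fun k => μ k < μ j ∨ (μ k = μ j ∧ j < k)).card

theorem IsSort.inv_add_rankAfter {N : ℕ} {μ : Comp N} {w : Equiv.Perm (Fin N)} (h : IsSort μ w)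
    (j : Fin N) : (w⁻¹ j : ℕ) + rankAfter μ j + 1 = N := by
  have h1 : rankAfter μ j = (Finset.Ioi (w⁻¹ j)).card := by
    refine Finset.card_equiv w⁻¹ fun k => ?_
    rw [Finset.mem_Ioi, h]
    simp [eq_comm]
  rw [h1, Fin.card_Ioi]
  have := (w⁻¹ j).2
  omega

/-- With indices counted from `0`, the coordinate `l` occurs with sign plus in `N - 1 - l` positive
roots and with sign minus in `l` of them. -/
theorem rho_apply {N : ℕ} (l : Fin N) : rho N l = ((N : ℝ) - 1) / 2 - l := by
  classical
  have hinj : Set.InjOn (fun p : Fin N × Fin N => (eps p.1 - eps p.2 : Fin N → ℝ))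
      ((Finset.univ.filter fun p : Fin N × Fin N => p.1 < p.2) : Finset (Fin N × Fin N)) := by
    rintro ⟨i, k⟩ h ⟨i', k'⟩ - e
    simp only [Finset.coe_filter, Finset.mem_univ, true_and, Set.mem_ofPred_eq] at h
    obtain ⟨rfl, rfl⟩ := eps_sub_eps_inj h.ne e
    rfl
  have h1 : ∑ i : Fin N, ∑ k : Fin N, (if i < k then (if l = i then (1 : ℝ) else 0) else 0) =
      (Finset.Ioi l).card := by
    rw [Finset.sum_eq_single l (fun i _ hi => by simp [hi.symm]) (by simp)]
    simp [Finset.filter_lt_eq_Ioi]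
  have h2 : ∑ i : Fin N, ∑ k : Fin N, (if i < k then (if l = k then (1 : ℝ) else 0) else 0) =
      (Finset.Iio l).card := by
    rw [Finset.sum_comm, Finset.sum_eq_single l (fun i _ hi => by simp [hi.symm]) (by simp)]
    simp [Finset.filter_gt_eq_Iio]
  have h3 : ∀ i k : Fin N, (if i < k then (eps i - eps k : Fin N → ℝ) l else 0) =
      (if i < k then (if l = i then (1 : ℝ) else 0) else 0) -
        (if i < k then (if l = k then (1 : ℝ) else 0) else 0) := fun i k => by
    split_ifs <;> simp_all [eps]
  rw [rho, Pi.smul_apply, Finset.sum_apply, posRoots, Finset.sum_image hinj, Finset.sum_filter,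
    Fintype.sum_prod_type]
  simp only [h3, Finset.sum_sub_distrib, h1, h2, Fin.card_Ioi, Fin.card_Iio, smul_eq_mul]
  have h4 : N - 1 - (l : ℕ) + l + 1 = N := by omega
  have h5 : ((N - 1 - (l : ℕ) : ℕ) : ℝ) + l + 1 = N := by exact_mod_cast h4
  linarith

theorem IsSort.rho_inv {N : ℕ} {μ : Comp N} {w : Equiv.Perm (Fin N)} (h : IsSort μ w)
    (j : Fin N) : rho N (w⁻¹ j) = rankAfter μ j - ((N : ℝ) - 1) / 2 := by
  have h1 : ((w⁻¹ j : ℕ) : ℝ) + rankAfter μ j + 1 = N := by exact_mod_cast h.inv_add_rankAfter j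
  rw [rho_apply]
  linarith

theorem rhoAt_apply {N : ℕ} (μ : Comp N) (j : Fin N) :
    rhoAt μ j = rankAfter μ j - ((N : ℝ) - 1) / 2 :=
  (isSort_shortest μ).rho_inv j

/-- The `j`-th spectral value of `μ`, without the shift common to all of them. -/
def spec {N : ℕ} (κ : ℝ) (μ : Comp N) (j : Fin N) : ℝ := μ j + κ * rankAfter μ j

theorem rankAfter_lt {N : ℕ} {μ : Comp N} {j k : Fin N}
    (h : μ k < μ j ∨ (μ k = μ j ∧ j < k)) : rankAfter μ k < rankAfter μ j := by
  have h1 := (isSort_shortest μ).inv_add_rankAfter j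
  have h2 := (isSort_shortest μ).inv_add_rankAfter k
  have h3 := ((isSort_shortest μ) j k).2 (by omega)
  rw [Fin.lt_def] at h3
  omega

/-- For `κ > 0` the numerical order of the spectral values is the sorting order of the entries.
Equal spectra thus have equal ranks, and subtracting the ranks recovers the entries; for `κ = 0` the
values are the entries. -/
theorem spec_injective {N : ℕ} {κ : ℝ} (hκ : 0 ≤ κ) {μ ν : Comp N}
    (h : ∀ j, spec κ μ j = spec κ ν j) : μ = ν := by
  rcases hκ.eq_or_lt with rfl | hκ
  · ext j
    have := h j
    simp only [spec, zero_mul, add_zero] at this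
    exact_mod_cast this
  · have key : ∀ (μ : Comp N) (j k), (μ k < μ j ∨ (μ k = μ j ∧ j < k)) ↔
        spec κ μ k < spec κ μ j := by
      have h1 : ∀ (μ : Comp N) (j k), (μ k < μ j ∨ (μ k = μ j ∧ j < k)) →
          spec κ μ k < spec κ μ j := by
        intro μ j k h
        have h1 : (rankAfter μ k : ℝ) < rankAfter μ j := by exact_mod_cast rankAfter_lt h
        have h2 : (μ k : ℝ) ≤ μ j := by exact_mod_cast (by omega : μ k ≤ μ j)
        have := mul_lt_mul_of_pos_left h1 hκ
        unfold spec
        linarith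
      intro μ j k
      refine ⟨h1 μ j k, fun h => ?_⟩
      by_contra hc
      by_cases hjk : j = k
      · subst hjk; exact lt_irrefl _ h
      · exact lt_asymm h (h1 μ k j (by omega))
    have hr : ∀ j, rankAfter μ j = rankAfter ν j := fun j => by
      unfold rankAfter
      congr 1
      ext k
      simp only [Finset.mem_filter, Finset.mem_univ, true_and, key, h]
    ext j
    have := h j
    simp only [spec, hr, add_left_inj] at this
    exact_mod_cast this

/-! ### The order on compositions -/

theorem eq_of_sum_Iic_eq {N : ℕ} {M : Type*} [AddCommGroup M] {f g : Fin N → M}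
    (h : ∀ l, ∑ k ∈ Finset.Iic l, f k = ∑ k ∈ Finset.Iic l, g k) : f = g := by
  funext l
  induction l using WellFoundedLT.induction with
  | ind l ih =>
    have h1 := h l
    rw [← Finset.Iio_insert, Finset.sum_insert (by simp), Finset.sum_insert (by simp),
      Finset.sum_congr rfl fun k hk => ih k (Finset.mem_Iio.1 hk)] at h1
    exact add_right_cancel h1

theorem Comp.plus_apply {N : ℕ} (μ : Comp N) (i : Fin N) : μ.plus i = μ (shortest μ i) := rfl

theorem isPartition_plus {N : ℕ} (μ : Comp N) : μ.plus.IsPartition :=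
  (exists_shortest μ).choose_spec.1

theorem act_act {N : ℕ} (v w : Equiv.Perm (Fin N)) (μ : Comp N) :
    Comp.act v (Comp.act w μ) = Comp.act (v * w) μ := by
  ext i; simp [Comp.act_apply, mul_inv_rev]

theorem act_plus {N : ℕ} (μ : Comp N) : Comp.act (shortest μ) μ.plus = μ := by
  rw [Comp.plus, act_act, mul_inv_cancel]
  ext i; rfl

theorem act_mem_orbit {N : ℕ} (w : Equiv.Perm (Fin N)) (μ : Comp N) : Comp.act w μ ∈ μ.orbit :=
  ⟨w, rfl⟩

theorem IsPartition.eq_of_mem_orbit {N : ℕ} {μ ν : Comp N} (hμ : μ.IsPartition)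
    (hν : ν.IsPartition) (h : ν ∈ μ.orbit) : ν = μ := by
  obtain ⟨w, rfl⟩ := h
  have := Tuple.unique_monotone (f := fun i => OrderDual.toDual (μ i)) (σ := w⁻¹) (τ := 1)
    (fun i j hij => hν hij) (fun i j hij => hμ hij)
  ext i
  exact congrArg OrderDual.ofDual (congrFun this i)

theorem plus_eq_of_mem_orbit {N : ℕ} {μ μp : Comp N} (hμp : μp.IsPartition) (h : μ ∈ μp.orbit) :
    μ.plus = μp := by
  obtain ⟨w, rfl⟩ := h
  refine IsPartition.eq_of_mem_orbit hμp (isPartition_plus _) ?_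
  rw [Comp.plus, act_act]
  exact act_mem_orbit _ _

theorem mem_orbit_plus_iff {N : ℕ} {μ ν : Comp N} : ν ∈ μ.plus.orbit ↔ ν.plus = μ.plus :=
  ⟨plus_eq_of_mem_orbit (isPartition_plus μ), fun h => h ▸ ⟨shortest ν, act_plus ν⟩⟩

theorem plus_act {N : ℕ} (w : Equiv.Perm (Fin N)) (μ : Comp N) : (Comp.act w μ).plus = μ.plus := by
  refine plus_eq_of_mem_orbit (isPartition_plus μ) ⟨w * shortest μ, ?_⟩
  simp only
  rw [← act_act, act_plus]

theorem degree_act {N : ℕ} (w : Equiv.Perm (Fin N)) (μ : Comp N) :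
    (Comp.act w μ).degree = μ.degree := by
  rw [Finsupp.degree_eq_sum, Finsupp.degree_eq_sum]
  exact Equiv.sum_comp w⁻¹ fun i => μ i

theorem degree_plus {N : ℕ} (μ : Comp N) : μ.plus.degree = μ.degree := degree_act _ _

theorem DomLT.antisymm {N : ℕ} {μ ν : Comp N} (h1 : DomLT μ ν) (h2 : DomLT ν μ) : False := by
  refine h1.1 (Finsupp.ext fun i => ?_)
  have := eq_of_sum_Iic_eq (f := fun i => (μ i : ℤ)) (g := fun i => (ν i : ℤ)) fun l => by
    exact_mod_cast (h1.2.2 l).antisymm (h2.2.2 l)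
  exact_mod_cast congrFun this i

theorem DomLT.trans {N : ℕ} {κ μ ν : Comp N} (h1 : DomLT κ μ) (h2 : DomLT μ ν) : DomLT κ ν :=
  ⟨fun e => (e ▸ h1).antisymm h2, h1.2.1.trans h2.2.1, fun l => (h1.2.2 l).trans (h2.2.2 l)⟩

/-- Initial sums are nonnegative on every simple root. As they determine a vector, the cone contains
no line, whence antisymmetry of the order. -/
theorem sum_Iic_nonneg_of_mem_rootCone {N : ℕ} {v : Fin N → ℝ} (hv : v ∈ rootCone N) (l : Fin N) :
    0 ≤ ∑ k ∈ Finset.Iic l, v k := by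
  induction hv using AddSubmonoid.closure_induction with
  | mem x hx =>
    obtain ⟨j, rfl⟩ := hx
    have := lo_lt_hi j
    simp only [simpleRoot, eps, Pi.sub_apply, Finset.sum_sub_distrib, Pi.single_apply,
      Finset.sum_ite_eq', Finset.mem_Iic]
    split_ifs with h1 h2 <;> norm_num
    exact absurd (this.le.trans ‹_›) h1
  | zero => simp
  | add x y _ _ hx hy =>
    simp only [Pi.add_apply, Finset.sum_add_distrib]
    exact add_nonneg hx hy

theorem eq_zero_of_mem_rootCone {N : ℕ} {v : Fin N → ℝ} (h1 : v ∈ rootCone N)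
    (h2 : -v ∈ rootCone N) : v = 0 := by
  refine eq_of_sum_Iic_eq fun l => ?_
  have h3 := sum_Iic_nonneg_of_mem_rootCone h1 l
  have h4 := sum_Iic_nonneg_of_mem_rootCone h2 l
  simp only [Pi.neg_apply, Finset.sum_neg_distrib, Pi.zero_apply, Finset.sum_const_zero] at h4 ⊢
  linarith

theorem eps_sub_eps_mem_rootCone {N : ℕ} {i k : Fin N} (h : i ≤ k) :
    (eps i - eps k : Fin N → ℝ) ∈ rootCone N := by
  obtain ⟨i, hi'⟩ := i
  obtain ⟨k, hk⟩ := k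
  simp only [Fin.mk_le_mk] at h
  induction k, h using Nat.le_induction with
  | base => simp
  | succ k hik ih =>
    have h1 := (rootCone N).add_mem (ih (by omega)) (AddSubmonoid.subset_closure
      ⟨(⟨k, by omega⟩ : Fin (N - 1)), rfl⟩)
    rw [simpleRoot, sub_add_sub_comm, lo, hi, add_comm (eps (⟨k, _⟩ : Fin N))] at h1
    simpa using h1

theorem precEq_iff {N : ℕ} {μ ν : Comp N} :
    PrecEq ν μ ↔ DomLT ν.plus μ.plus ∨ (ν.plus = μ.plus ∧ μ.vec - ν.vec ∈ rootCone N) := by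
  rw [PrecEq, mem_orbit_plus_iff]
  constructor
  · rintro (h | h)
    exacts [Or.inl h.2, Or.inr h]
  · rintro (h | h)
    exacts [Or.inl ⟨h.1, h⟩, Or.inr h]

theorem PrecEq.degree_eq {N : ℕ} {μ ν : Comp N} (h : PrecEq ν μ) : ν.degree = μ.degree := by
  rw [← degree_plus ν, ← degree_plus μ]
  rcases precEq_iff.1 h with h | h
  exacts [h.2.1, by rw [h.1]]

theorem Comp.vec_injective {N : ℕ} : Function.Injective (Comp.vec (N := N)) := fun _ _ h =>
  Finsupp.ext fun i => Nat.cast_injective (R := ℝ) (congrFun h i)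

/-- The order on exponents which governs the triangularity of the Cherednik operators. -/
def Below {N : ℕ} (ν μ : Comp N) : Prop := PrecEq ν μ ∨ ν.degree < μ.degree

theorem Below.refl {N : ℕ} (μ : Comp N) : Below μ μ :=
  Or.inl (precEq_iff.2 (Or.inr ⟨rfl, by simp [(rootCone N).zero_mem]⟩))

theorem Below.trans {N : ℕ} {κ μ ν : Comp N} (h1 : Below κ μ) (h2 : Below μ ν) : Below κ ν := by
  rcases h1 with h1 | h1 <;> rcases h2 with h2 | h2
  · refine Or.inl (precEq_iff.2 ?_)
    rcases precEq_iff.1 h1 with h1 | h1 <;> rcases precEq_iff.1 h2 with h2 | h2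
    · exact Or.inl (h1.trans h2)
    · exact Or.inl (h2.1 ▸ h1)
    · exact Or.inl (h1.1 ▸ h2)
    · refine Or.inr ⟨h1.1.trans h2.1, ?_⟩
      have := (rootCone N).add_mem h2.2 h1.2
      rwa [sub_add_sub_cancel] at this
  · exact Or.inr (h1.degree_eq ▸ h2)
  · exact Or.inr (h2.degree_eq ▸ h1)
  · exact Or.inr (h1.trans h2)

theorem Below.antisymm {N : ℕ} {μ ν : Comp N} (h1 : Below μ ν) (h2 : Below ν μ) : μ = ν := by
  rcases h1 with h1 | h1 <;> rcases h2 with h2 | h2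
  · rcases precEq_iff.1 h1 with h1 | h1 <;> rcases precEq_iff.1 h2 with h2 | h2
    · exact (h1.antisymm h2).elim
    · exact absurd h2.1.symm h1.1
    · exact absurd h1.1.symm h2.1
    · refine Comp.vec_injective (sub_eq_zero.1 (eq_zero_of_mem_rootCone h2.2 ?_))
      rw [neg_sub]
      exact h1.2
  · exact absurd h1.degree_eq h2.ne'
  · exact absurd h2.degree_eq h1.ne'
  · exact absurd h1 h2.not_gt

/-- The partial order `Below`. -/
abbrev belowOrder (N : ℕ) : PartialOrder (Comp N) where
  le := Below
  lt ν μ := Below ν μ ∧ ¬Below μ ν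
  le_refl := Below.refl
  le_trans _ _ _ := Below.trans
  le_antisymm _ _ := Below.antisymm

/-- Strictly below. -/
def SBelow {N : ℕ} (ν μ : Comp N) : Prop := Below ν μ ∧ ν ≠ μ

theorem SBelow.of_degree_lt {N : ℕ} {μ ν : Comp N} (h : ν.degree < μ.degree) : SBelow ν μ :=
  ⟨Or.inr h, fun e => h.ne (by rw [e])⟩

theorem SBelow.swap {N : ℕ} {μ : Comp N} {j k : Fin N} (hjk : j < k) (h : μ k < μ j) :
    SBelow (Comp.act (Equiv.swap j k) μ) μ := by
  refine ⟨Or.inl (precEq_iff.2 (Or.inr ⟨plus_act _ _, ?_⟩)), fun e => ?_⟩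
  · have : μ.vec - (Comp.act (Equiv.swap j k) μ).vec = (μ j - μ k) • (eps j - eps k) := by
      funext i
      simp only [Pi.sub_apply, Comp.vec, Comp.act_apply, Equiv.swap_inv, Equiv.swap_apply_def,
        Pi.smul_apply, eps, Pi.single_apply, nsmul_eq_mul, Nat.cast_sub h.le]
      split_ifs with h1 h2
      · subst h1 h2; exact absurd hjk (lt_irrefl _)
      · subst h1; ring
      · simp [‹i = k›]
      · simp
    rw [this]
    exact (rootCone N).nsmul_mem (eps_sub_eps_mem_rootCone hjk.le) _
  · have := DFunLike.congr_fun e j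
    rw [Comp.act_apply, Equiv.swap_inv, Equiv.swap_apply_left] at this
    omega

/-- After removal of the common indices, two sets of equal size remain, and the value `f l`
separates them. -/
theorem sum_le_sum_Iic_of_antitone {N : ℕ} {f : Fin N → ℕ} (hf : Antitone f) (l : Fin N)
    {A : Finset (Fin N)} (hA : A.card = (Finset.Iic l).card) :
    ∑ i ∈ A, f i ≤ ∑ i ∈ Finset.Iic l, f i := by
  rw [← Finset.sum_inter_add_sum_sdiff A (Finset.Iic l),
    ← Finset.sum_inter_add_sum_sdiff (Finset.Iic l) A, Finset.inter_comm]
  refine Nat.add_le_add_left ?_ _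
  have h1 : (A \ Finset.Iic l).card = (Finset.Iic l \ A).card := by
    have := Finset.card_sdiff_add_card_inter A (Finset.Iic l)
    have := Finset.card_sdiff_add_card_inter (Finset.Iic l) A
    rw [Finset.inter_comm] at this
    omega
  calc ∑ i ∈ A \ Finset.Iic l, f i ≤ (A \ Finset.Iic l).card • f l :=
        Finset.sum_le_card_nsmul _ _ _ fun i hi => hf (by
          simp only [Finset.mem_sdiff, Finset.mem_Iic, not_le] at hi; exact hi.2.le)
    _ = (Finset.Iic l \ A).card • f l := by rw [h1]
    _ ≤ _ := Finset.card_nsmul_le_sum _ _ _ fun i hi => hf (by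
          simp only [Finset.mem_sdiff, Finset.mem_Iic] at hi; exact hi.1)

theorem sum_le_sum_plus {N : ℕ} (μ : Comp N) (l : Fin N) {A : Finset (Fin N)}
    (hA : A.card = (Finset.Iic l).card) : ∑ i ∈ A, μ i ≤ ∑ i ∈ Finset.Iic l, μ.plus i := by
  have := sum_le_sum_Iic_of_antitone (isPartition_plus μ) l
    (A := A.map (shortest μ)⁻¹.toEmbedding) (by rw [Finset.card_map, hA])
  rw [Finset.sum_map] at this
  simpa [Comp.plus_apply, perm_apply_inv_self] using this

/-- Moving two entries closer together goes down in the dominance order. -/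
theorem SBelow.inner {N : ℕ} {μ ν : Comp N} {j k : Fin N} (hjk : j ≠ k)
    (hoff : ∀ i, i ≠ j → i ≠ k → ν i = μ i) (hsum : ν j + ν k = μ j + μ k) (hj : ν j < μ j)
    (hk : ν k < μ j) : SBelow ν μ := by
  have hne : ν ≠ μ := fun e => by rw [e] at hj; exact lt_irrefl _ hj
  have hsplit : ∀ f : Fin N → ℕ, ∑ i, f i = f j + (f k + ∑ i ∈ (Finset.univ.erase j).erase k, f i) :=
    fun f => by
      rw [Finset.add_sum_erase _ f (by simp [hjk.symm]), Finset.add_sum_erase _ f (by simp)]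
  have hoff' : ∀ i ∈ (Finset.univ.erase j).erase k, ν i = μ i := fun i hi => by
    simp only [Finset.mem_erase, Finset.mem_univ, and_true] at hi
    exact hoff i hi.2 hi.1
  have hsumoff : ∑ i ∈ (Finset.univ.erase j).erase k, ν i =
      ∑ i ∈ (Finset.univ.erase j).erase k, μ i := Finset.sum_congr rfl hoff'
  refine ⟨Or.inl (precEq_iff.2 (Or.inl ⟨fun e => ?_, ?_, fun l => ?_⟩)), hne⟩
  -- The sum of squares is constant on orbits but drops strictly when two entries move closer
  -- together, so the orbits differ.
  · have hsq : ∀ κ : Comp N, ∑ i, κ.plus i ^ 2 = ∑ i, κ i ^ 2 := fun κ =>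
      Equiv.sum_comp (shortest κ) fun i => κ i ^ 2
    have h1 : ∑ i, ν i ^ 2 = ∑ i, μ i ^ 2 := by rw [← hsq ν, ← hsq μ, e]
    rw [hsplit, hsplit fun i => μ i ^ 2, Finset.sum_congr rfl fun i hi => by rw [hoff' i hi]] at h1
    obtain ⟨c, hc⟩ := Nat.exists_eq_add_of_lt hj
    obtain ⟨d, hd⟩ := Nat.exists_eq_add_of_lt hk
    have h2 : ν k = μ k + c + 1 := by omega
    have h3 : ν j = μ k + d + 1 := by omega
    rw [hc, h2, h3] at h1
    nlinarith
  · rw [degree_plus, degree_plus, Finsupp.degree_eq_sum, Finsupp.degree_eq_sum, hsplit,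
      hsplit fun i => μ i, hsumoff]
    omega
  -- An initial sum of `ν.plus` is a sum of `ν` over some set `A`. If `A` contains `k` but not `j`,
  -- replacing `k` by `j` uses `ν k < μ j`; otherwise `A` itself can be kept.
  · have h1 : ∑ i ∈ Finset.Iic l, ν.plus i =
        ∑ i ∈ (Finset.Iic l).map (shortest ν).toEmbedding, ν i := by
      rw [Finset.sum_map]; rfl
    have hcard : ((Finset.Iic l).map (shortest ν).toEmbedding).card = (Finset.Iic l).card :=
      Finset.card_map _
    rw [h1]
    generalize (Finset.Iic l).map (shortest ν).toEmbedding = A at hcard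
    by_cases hkA : k ∈ A
    · by_cases hjA : j ∈ A
      · refine le_trans (le_of_eq ?_) (sum_le_sum_plus μ l hcard)
        have hs : ∀ f : Fin N → ℕ, ∑ i ∈ A, f i = f j + (f k + ∑ i ∈ (A.erase j).erase k, f i) :=
          fun f => by
            rw [Finset.add_sum_erase _ f (by simp [hjk.symm, hkA]), Finset.add_sum_erase _ f hjA]
        have hs' : ∑ i ∈ (A.erase j).erase k, ν i = ∑ i ∈ (A.erase j).erase k, μ i :=
          Finset.sum_congr rfl fun i hi => hoff' i
            (Finset.erase_subset_erase _ (Finset.erase_subset_erase _ (Finset.subset_univ A)) hi)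
        rw [hs, hs fun i => μ i, hs']
        omega
      · have hB : (insert j (A.erase k)).card = (Finset.Iic l).card := by
          rw [Finset.card_insert_of_notMem (by simp [hjA]), Finset.card_erase_add_one hkA, hcard]
        refine le_trans ?_ (sum_le_sum_plus μ l hB)
        rw [Finset.sum_insert (by simp [hjA]), ← Finset.add_sum_erase A (fun i => ν i) hkA]
        refine Nat.add_le_add hk.le (Finset.sum_le_sum fun i hi => ?_)
        have h2 := Finset.mem_erase.1 hi
        exact (hoff i (fun e => hjA (e ▸ h2.2)) h2.1).le
    · refine le_trans (Finset.sum_le_sum fun i hi => ?_) (sum_le_sum_plus μ l hcard)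
      by_cases hij : i = j
      · rw [hij]; exact hj.le
      · exact (hoff i hij fun e => hkA (e ▸ hi)).le

/-! ### Triangularity of the Cherednik operators -/

/-- The polynomials all of whose exponents satisfy `P`. -/
def suppSub {N : ℕ} (P : Comp N → Prop) : Submodule ℂ (Poly N) where
  carrier := {f | ∀ ν, coeff ν f ≠ 0 → P ν}
  zero_mem' := by simp
  add_mem' {f g} hf hg ν h := by
    rw [coeff_add] at h
    by_cases h1 : coeff ν f = 0
    · exact hg ν (by simpa [h1] using h)
    · exact hf ν h1
  smul_mem' c f hf ν h := hf ν (by rw [coeff_smul] at h; exact right_ne_zero_of_smul h)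

theorem suppSub_mono {N : ℕ} {P Q : Comp N → Prop} (h : ∀ ν, P ν → Q ν) :
    suppSub P ≤ suppSub Q := fun _ hf ν hν => h ν (hf ν hν)

theorem monomial_mem_suppSub {N : ℕ} {P : Comp N → Prop} {ν : Comp N} (h : P ν) (c : ℂ) :
    (monomial ν c : Poly N) ∈ suppSub P := fun κ hκ => by
  rw [coeff_monomial] at hκ
  split_ifs at hκ with e
  · exact e ▸ h
  · exact absurd rfl hκ

theorem map_mem_of_monomial {N : ℕ} {P : Comp N → Prop} {L : Submodule ℂ (Poly N)} {A : Op N}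
    (h : ∀ ν, P ν → A (monomial ν 1) ∈ L) {f : Poly N} (hf : f ∈ suppSub P) : A f ∈ L := by
  rw [f.as_sum, map_sum]
  refine L.sum_mem fun ν hν => ?_
  rw [← mul_one (coeff ν f), ← smul_eq_mul, ← smul_monomial, map_smul]
  exact L.smul_mem _ (h ν (hf ν (mem_support_iff.1 hν)))

theorem Kop_monomial {N : ℕ} (j k : Fin N) (μ : Comp N) (c : ℂ) :
    Kop j k (monomial μ c) = monomial (Comp.act (Equiv.swap j k) μ) c := by
  rw [Comp.act, Finsupp.equivMapDomain_eq_mapDomain]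
  exact rename_monomial _ _ _

theorem Top_monomial {N : ℕ} (j : Fin N) (μ : Comp N) (c : ℂ) :
    Top j (monomial μ c) = (-1 : ℂ) ^ μ j • monomial μ c := by
  have h1 : ∀ i, (if i = j then -X i else X i : Poly N) ^ μ i =
      (if i = j then (-1) ^ μ i else 1) * X i ^ μ i := fun i => by
    split_ifs
    · rw [neg_pow]
    · rw [one_mul]
  rw [Top, flip, AlgHom.toLinearMap_apply, aeval_monomial, monomial_eq,
    Finsupp.prod_fintype _ _ (by simp), Finsupp.prod_fintype _ _ (by simp)]
  simp only [h1, Finset.prod_mul_distrib, Finset.prod_ite_eq', Finset.mem_univ, if_true]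
  rw [smul_eq_C_mul, map_pow, map_neg, map_one, MvPolynomial.algebraMap_eq]
  ring

theorem Top_Top_Kop_monomial {N : ℕ} (j k : Fin N) (μ : Comp N) :
    (Top j * Top k * Kop j k) (monomial μ 1) =
      (-1 : ℂ) ^ (μ j + μ k) • monomial (Comp.act (Equiv.swap j k) μ) 1 := by
  simp only [Module.End.mul_apply, Kop_monomial, Top_monomial, map_smul, smul_smul, Comp.act_apply,
    Equiv.swap_inv, Equiv.swap_apply_left, Equiv.swap_apply_right]
  rw [pow_add]

/-- A geometric sum. After multiplication by `X j` its terms are the pure power of `X j` and terms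
with positive exponents at both `j` and `k`; the submodule `L` is to absorb the latter, which are
lower in dominance. -/
theorem exists_geom_quotient {N : ℕ} (j k : Fin N) (s : ℂ) (g : Comp N) (e : ℕ) :
    ∃ G : Poly N, (X j - C s * X k) * G = monomial (g + Finsupp.single j (e + 1)) 1 -
        s ^ (e + 1) • monomial (g + Finsupp.single k (e + 1)) 1 ∧
      G ∈ suppSub (fun ν => ν.degree = g.degree + e) ∧
      ∀ L : Submodule ℂ (Poly N), (∀ a b, a + b = e + 1 → 0 < a → 0 < b →
        monomial (g + Finsupp.single j a + Finsupp.single k b) 1 ∈ L) →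
        X j * G - monomial (g + Finsupp.single j (e + 1)) 1 ∈ L := by
  have key : ∀ a b, X j ^ a * (C s * X k) ^ b * monomial g (1 : ℂ) =
      s ^ b • monomial (g + Finsupp.single j a + Finsupp.single k b) (1 : ℂ) := fun a b => by
    rw [mul_pow, X_pow_eq_monomial, X_pow_eq_monomial, ← map_pow, smul_monomial, mul_left_comm,
      monomial_mul, mul_assoc, monomial_mul, C_mul_monomial]
    rw [add_assoc g, add_comm g]
    simp
  refine ⟨(∑ i ∈ Finset.range (e + 1), X j ^ i * (C s * X k) ^ (e + 1 - 1 - i)) * monomial g 1,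
    ?_, ?_, fun L hL => ?_⟩
  · rw [← mul_assoc, mul_comm (X j - C s * X k), geom_sum₂_mul, sub_mul]
    have h1 := key (e + 1) 0
    have h2 := key 0 (e + 1)
    simp only [pow_zero, mul_one, one_mul, one_smul, Finsupp.single_zero, add_zero] at h1 h2
    rw [h1, h2]
  · rw [Finset.sum_mul]
    refine Submodule.sum_mem _ fun i hi => ?_
    rw [key]
    refine Submodule.smul_mem _ _ (monomial_mem_suppSub ?_ _)
    have := Finset.mem_range.1 hi
    simp only [map_add, Finsupp.degree_single]
    omega
  · have h1 : X j * ((∑ i ∈ Finset.range (e + 1), X j ^ i * (C s * X k) ^ (e + 1 - 1 - i)) *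
        monomial g 1) = ∑ i ∈ Finset.range (e + 1),
          s ^ (e - i) • monomial (g + Finsupp.single j (i + 1) + Finsupp.single k (e - i)) (1 : ℂ) := by
      rw [Finset.sum_mul, Finset.mul_sum]
      refine Finset.sum_congr rfl fun i _ => ?_
      rw [← key, Nat.add_sub_cancel]
      ring
    rw [h1, Finset.sum_range_succ, Nat.sub_self, pow_zero, one_smul, Finsupp.single_zero, add_zero,
      add_sub_cancel_right]
    refine L.sum_mem fun i hi => L.smul_mem _ (hL _ _ ?_ ?_ ?_) <;>
    · have := Finset.mem_range.1 hi
      omega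

theorem act_swap_add_single {N : ℕ} {j k : Fin N} (hjk : j ≠ k) {g : Comp N} (hg : g j = g k)
    (d : ℕ) : Comp.act (Equiv.swap j k) (g + Finsupp.single j d) = g + Finsupp.single k d := by
  ext i
  rw [Comp.act_apply, Equiv.swap_inv, Finsupp.add_apply, Finsupp.add_apply]
  by_cases h1 : i = j
  · rw [h1, Equiv.swap_apply_left, Finsupp.single_eq_of_ne hjk.symm, Finsupp.single_eq_of_ne hjk,
      hg]
  · by_cases h2 : i = k
    · rw [h2, Equiv.swap_apply_right, Finsupp.single_eq_same, Finsupp.single_eq_same, hg]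
    · rw [Equiv.swap_apply_of_ne_of_ne h1 h2, Finsupp.single_eq_of_ne h1,
        Finsupp.single_eq_of_ne h2]

theorem SBelow.add_single {N : ℕ} {j k : Fin N} (hjk : j ≠ k) {g : Comp N} (hg : g j = g k)
    {a b d : ℕ} (hd : a + b = d) (ha : 0 < a) (hb : 0 < b) :
    SBelow (g + Finsupp.single j a + Finsupp.single k b) (g + Finsupp.single j d) := by
  have h1 : ∀ c : ℕ, Finsupp.single j c k = 0 := fun c => Finsupp.single_eq_of_ne hjk.symm
  have h2 : ∀ c : ℕ, Finsupp.single k c j = 0 := fun c => Finsupp.single_eq_of_ne hjk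
  refine SBelow.inner hjk (fun i hj hk => ?_) ?_ ?_ ?_
  · simp only [Finsupp.add_apply, Finsupp.single_eq_of_ne hj, Finsupp.single_eq_of_ne hk,
      add_zero]
  all_goals simp only [Finsupp.add_apply, Finsupp.single_eq_same, h1, h2]; omega

/-- The quotient `(x_j - s x_k)⁻¹ (1 - σ) x^μ`, for `s = ±1` and `σ` the exchange of `x_j` and
`s x_k`. -/
theorem exists_quotient {N : ℕ} {j k : Fin N} (hjk : j ≠ k) {s : ℂ} (hs : s * s = 1)
    (μ : Comp N) : ∃ q : Poly N,
      (X j - C s * X k) * q =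
        monomial μ 1 - s ^ (μ j + μ k) • monomial (Comp.act (Equiv.swap j k) μ) 1 ∧
      q ∈ suppSub (fun ν => ν.degree < μ.degree) ∧
      X j * q + (if j < k then s ^ (μ j + μ k) • monomial (Comp.act (Equiv.swap j k) μ) 1 else 0) -
        (if μ k < μ j ∨ (μ k = μ j ∧ j < k) then monomial μ 1 else 0) ∈
          suppSub (fun ν => SBelow ν μ) := by
  have hs2 : ∀ n d : ℕ, s ^ (n + d + n) = s ^ d := fun n d => by
    rw [show n + d + n = 2 * n + d by ring, pow_add, pow_mul, pow_two, hs, one_pow, one_mul]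
  rcases lt_trichotomy (μ k) (μ j) with h | h | h
  · obtain ⟨e, he⟩ := Nat.exists_eq_add_of_lt h
    -- Here `e + 1 = μ j - μ k`, and removing this excess leaves `g` with equal entries at `j` and
    -- `k`. The sign from the common part is an even power of `s`.
    obtain ⟨g, rfl⟩ : ∃ g, μ = g + Finsupp.single j (e + 1) :=
      ⟨μ - Finsupp.single j (e + 1), by
        rw [tsub_add_cancel_of_le]
        rw [Finsupp.single_le_iff]; omega⟩
    simp only [Finsupp.add_apply, Finsupp.single_eq_same, Finsupp.single_eq_of_ne hjk.symm,
      add_zero] at he h ⊢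
    have hg : g j = g k := by omega
    obtain ⟨G, h1, h2, h3⟩ := exists_geom_quotient j k s g e
    have hL := h3 (suppSub fun ν => SBelow ν (g + Finsupp.single j (e + 1)))
      fun a b hab ha hb => monomial_mem_suppSub
        (P := fun ν => SBelow ν (g + Finsupp.single j (e + 1))) (SBelow.add_single hjk hg hab ha hb) 1
    rw [hg, hs2, act_swap_add_single hjk hg]
    refine ⟨G, h1, suppSub_mono (fun ν hν => ?_) h2, ?_⟩
    · simp only [map_add, Finsupp.degree_single]; omega
    · rw [if_pos (Or.inl (by omega)), add_sub_right_comm]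
      refine Submodule.add_mem _ hL ?_
      split_ifs with hlt
      · refine Submodule.smul_mem _ _ (monomial_mem_suppSub ?_ _)
        rw [← act_swap_add_single hjk hg]
        exact SBelow.swap hlt (by simp [hjk, hg])
      · exact Submodule.zero_mem _
  · refine ⟨0, ?_, Submodule.zero_mem _, ?_⟩ <;>
    have hact : Comp.act (Equiv.swap j k) μ = μ := by
      ext i
      simp only [Comp.act_apply, Equiv.swap_inv, Equiv.swap_apply_def]
      split_ifs <;> simp_all
    · have := hs2 (μ j) 0
      rw [add_zero, pow_zero] at this
      rw [hact, h, this, one_smul, mul_zero, sub_self]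
    · have := hs2 (μ j) 0
      rw [add_zero, pow_zero] at this
      simp only [hact, h, this, one_smul, mul_zero, zero_add, lt_irrefl, true_and, false_or,
        sub_self]
      exact Submodule.zero_mem _
  · obtain ⟨e, he⟩ := Nat.exists_eq_add_of_lt h
    obtain ⟨g, rfl⟩ : ∃ g, μ = g + Finsupp.single k (e + 1) :=
      ⟨μ - Finsupp.single k (e + 1), by
        rw [tsub_add_cancel_of_le]
        rw [Finsupp.single_le_iff]; omega⟩
    simp only [Finsupp.add_apply, Finsupp.single_eq_same, Finsupp.single_eq_of_ne hjk,
      add_zero] at he h ⊢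
    have hg : g k = g j := by omega
    obtain ⟨G, h1, h2, h3⟩ := exists_geom_quotient j k s g e
    have hL := h3 (suppSub fun ν => SBelow ν (g + Finsupp.single k (e + 1)))
      fun a b hab ha hb => by
        rw [add_right_comm]
        exact monomial_mem_suppSub (P := fun ν => SBelow ν (g + Finsupp.single k (e + 1)))
          (SBelow.add_single hjk.symm hg ((add_comm b a).trans hab) hb ha) 1
    have hact : Comp.act (Equiv.swap j k) (g + Finsupp.single k (e + 1)) =
        g + Finsupp.single j (e + 1) := by
      rw [Equiv.swap_comm, act_swap_add_single hjk.symm hg]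
    have hpow : s ^ (g j + (g k + (e + 1))) = s ^ (e + 1) := by
      rw [hg, ← hs2 (g j) (e + 1)]; congr 1; ring
    have hpow2 : s ^ (e + 1) * s ^ (e + 1) = 1 := by rw [← mul_pow, hs, one_pow]
    rw [hpow, hact]
    refine ⟨-(s ^ (e + 1) • G), ?_, Submodule.neg_mem _ (Submodule.smul_mem _ _
      (suppSub_mono (fun ν hν => ?_) h2)), ?_⟩
    · rw [mul_neg, mul_smul_comm, h1, smul_sub, smul_smul, hpow2, one_smul, neg_sub]
    · simp only [map_add, Finsupp.degree_single]; omega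
    · rw [if_neg (show ¬(g k + (e + 1) < g j ∨ g k + (e + 1) = g j ∧ j < k) by omega), sub_zero]
      have h4 : X j * -(s ^ (e + 1) • G) = -(s ^ (e + 1) •
          (X j * G - monomial (g + Finsupp.single j (e + 1)) 1)) -
          s ^ (e + 1) • monomial (g + Finsupp.single j (e + 1)) 1 := by
        rw [mul_neg, mul_smul_comm, smul_sub]; ring
      rw [h4, sub_add]
      refine Submodule.sub_mem _ (Submodule.neg_mem _ (Submodule.smul_mem _ _ hL)) ?_
      -- The quotient now produces the swapped monomial. For `j < k` it lies above `μ` and is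
      -- cancelled by the exchange term; for `k < j` it lies below `μ` and does no harm. This is why
      -- `d_j` contains exchanges with `k > j` only.
      split_ifs with hlt
      · rw [sub_self]; exact Submodule.zero_mem _
      · rw [sub_zero]
        refine Submodule.smul_mem _ _ (monomial_mem_suppSub ?_ _)
        rw [← hact, Equiv.swap_comm]
        exact SBelow.swap (lt_of_le_of_ne (not_lt.1 hlt) hjk.symm)
          (by simp [hjk.symm, hg])

theorem diffMinus_monomial {N : ℕ} {j k : Fin N} (hjk : k ≠ j) (μ : Comp N) :
    diffMinus j k (monomial μ 1) ∈ suppSub (fun ν => ν.degree < μ.degree) ∧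
    X j * diffMinus j k (monomial μ 1) + (if j < k then Kop j k (monomial μ 1) else 0) -
        (if μ k < μ j ∨ (μ k = μ j ∧ j < k) then monomial μ 1 else 0) ∈
          suppSub (fun ν => SBelow ν μ) := by
  obtain ⟨q, h1, h2, h3⟩ := exists_quotient hjk.symm (one_mul (1 : ℂ)) μ
  simp only [one_pow, one_smul, map_one, one_mul, ← Kop_monomial] at h1 h3
  have : diffMinus j k (monomial μ 1) = q :=
    mul_left_cancel₀ (X_sub_X_ne_zero hjk) (by rw [mul_diffMinus hjk, h1])
  rw [this]
  exact ⟨h2, h3⟩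

theorem diffPlus_monomial {N : ℕ} {j k : Fin N} (hjk : k ≠ j) (μ : Comp N) :
    diffPlus j k (monomial μ 1) ∈ suppSub (fun ν => ν.degree < μ.degree) ∧
    X j * diffPlus j k (monomial μ 1) +
        (if j < k then (Top j * Top k * Kop j k) (monomial μ 1) else 0) -
        (if μ k < μ j ∨ (μ k = μ j ∧ j < k) then monomial μ 1 else 0) ∈
          suppSub (fun ν => SBelow ν μ) := by
  obtain ⟨q, h1, h2, h3⟩ := exists_quotient hjk.symm (by norm_num : (-1 : ℂ) * -1 = 1) μ
  simp only [map_neg, map_one, neg_mul, one_mul, sub_neg_eq_add, ← Top_Top_Kop_monomial] at h1 h3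
  have : diffPlus j k (monomial μ 1) = q :=
    mul_left_cancel₀ (X_add_X_ne_zero j k) (by rw [mul_diffPlus hjk, h1])
  rw [this]
  exact ⟨h2, h3⟩

theorem mem_suppSub_of_X_mul {N : ℕ} {j : Fin N} {q : Poly N} {μ : Comp N} {c : ℂ}
    (h : X j * q = c • monomial μ 1) : q ∈ suppSub (fun ν => ν.degree < μ.degree) := by
  intro ν hν
  rw [← coeff_X_mul ν j q, h, coeff_smul, coeff_monomial] at hν
  split_ifs at hν with e
  · rw [e]; simp
  · simp at hν

theorem X_mul_diffFlip_monomial {N : ℕ} (j : Fin N) (μ : Comp N) :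
    X j * diffFlip j (monomial μ 1) = (1 - (-1 : ℂ) ^ μ j) • monomial μ 1 := by
  rw [mul_diffFlip, Top_monomial, sub_smul, one_smul]

theorem X_mul_pderiv_monomial_one {N : ℕ} (j : Fin N) (μ : Comp N) :
    X j * pderiv j (monomial μ 1) = (μ j : ℂ) • (monomial μ 1 : Poly N) := by
  rw [X_mul_pderiv_monomial, Nat.cast_smul_eq_nsmul]

theorem dunkl_monomial_mem {N : ℕ} (τ a b : ℂ) (j : Fin N) (μ : Comp N) :
    dunkl τ a b j (monomial μ 1) ∈ suppSub (fun ν => ν.degree < μ.degree) := by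
  simp only [dunkl, LinearMap.add_apply, LinearMap.smul_apply, LinearMap.sum_apply]
  refine Submodule.add_mem _ (Submodule.add_mem _ ?_ (Submodule.smul_mem _ _
    (Submodule.sum_mem _ fun k hk => ?_))) (Submodule.smul_mem _ _ ?_)
  · exact mem_suppSub_of_X_mul (X_mul_pderiv_monomial_one j μ)
  · have hk := Finset.ne_of_mem_erase hk
    exact Submodule.add_mem _ (diffMinus_monomial hk μ).1
      (Submodule.smul_mem _ _ (diffPlus_monomial hk μ).1)
  · exact mem_suppSub_of_X_mul (X_mul_diffFlip_monomial j μ)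

theorem dunkl_dunkl_monomial_mem {N : ℕ} (τ a b : ℂ) (j : Fin N) (μ : Comp N) :
    dunkl τ a b j (dunkl τ a b j (monomial μ 1)) ∈ suppSub (fun ν => SBelow ν μ) := by
  refine map_mem_of_monomial (P := fun ν => ν.degree < μ.degree) (fun ν hν => ?_)
    (dunkl_monomial_mem τ a b j μ)
  exact suppSub_mono (fun κ (hκ : κ.degree < ν.degree) => SBelow.of_degree_lt (hκ.trans hν))
    (dunkl_monomial_mem τ a b j ν)

/-- Modulo lower terms, each `k` contributes `a(1 + τ)` exactly when it is counted by `rankAfter μ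
j`. The part `b(1 - (-1)^{μ_j})` of `x_j ∇_j` and the value of `b t_j` add up to `b`, and `∇_j²`
lowers the degree. -/
theorem cherednik_monomial {N : ℕ} {τ b : ℂ} (h : IsType τ b) (a : ℂ) (ω : ℝ) (j : Fin N)
    (μ : Comp N) : cherednik τ a b ω j (monomial μ 1) -
      ((μ j : ℂ) + a * (1 + τ) * rankAfter μ j + b) • monomial μ 1 ∈
        suppSub (fun ν => SBelow ν μ) := by
  set x : Poly N := monomial μ 1 with hx
  have hsum : ∑ k ∈ Finset.Ioi j, exchPlus τ a j k x = a • ∑ k ∈ Finset.univ.erase j,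
      ((if j < k then Kop j k x else 0) +
        τ • (if j < k then (Top j * Top k * Kop j k) x else 0)) := by
    rw [Finset.smul_sum]
    refine Eq.trans ?_ (Finset.sum_subset (s₁ := Finset.Ioi j) ?_ ?_)
    · refine Finset.sum_congr rfl fun k hk => ?_
      rw [if_pos (Finset.mem_Ioi.1 hk), if_pos (Finset.mem_Ioi.1 hk), exchPlus, twist_mul_twist h]
      simp [add_mul]
    · intro k hk
      simpa using (Finset.mem_Ioi.1 hk).ne'
    · intro k _ hk
      rw [Finset.mem_Ioi] at hk
      simp [hk]
  have hrank : (rankAfter μ j : ℂ) • x = ∑ k ∈ Finset.univ.erase j,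
      (if μ k < μ j ∨ (μ k = μ j ∧ j < k) then x else 0) := by
    rw [Nat.cast_smul_eq_nsmul, rankAfter, ← Finset.sum_const, Finset.sum_filter,
      Finset.sum_erase _ (by simp)]
  have hd : cherednik τ a b ω j x = (μ j : ℂ) • x + b • x - (1 / (2 * ω) : ℂ) •
      dunkl τ a b j (dunkl τ a b j x) + a • ∑ k ∈ Finset.univ.erase j,
        ((X j * diffMinus j k x + if j < k then Kop j k x else 0) +
          τ • (X j * diffPlus j k x + if j < k then (Top j * Top k * Kop j k) x else 0)) := by
    have hX : X j * dunkl τ a b j x = (μ j : ℂ) • x + a • ∑ k ∈ Finset.univ.erase j,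
        (X j * diffMinus j k x + τ • (X j * diffPlus j k x)) +
          b • ((1 - (-1 : ℂ) ^ μ j) • x) := by
      simp only [dunkl, LinearMap.add_apply, LinearMap.smul_apply, LinearMap.sum_apply]
      rw [mul_add, mul_add, mul_smul_comm, mul_smul_comm, X_mul_diffFlip_monomial]
      simp only [Derivation.coeFn_coe, hx, X_mul_pderiv_monomial_one, Finset.mul_sum, mul_add,
        mul_smul_comm]
    have hT : b • twist τ j x = b • ((-1 : ℂ) ^ μ j • x) := by
      rw [twist, LinearMap.smul_apply, smul_smul, h.mul_b, hx, Top_monomial]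
    simp only [cherednik, creat, LinearMap.add_apply, LinearMap.smul_apply, LinearMap.sum_apply,
      Module.End.mul_apply, LinearMap.sub_apply, hsum, hT]
    rw [show Xop j (dunkl τ a b j x) = X j * dunkl τ a b j x from rfl, hX]
    simp only [smul_add, Finset.sum_add_distrib, sub_smul, one_smul, smul_sub]
    abel
  have hfin : cherednik τ a b ω j x - ((μ j : ℂ) + a * (1 + τ) * rankAfter μ j + b) • x =
      a • ∑ k ∈ Finset.univ.erase j,
        ((X j * diffMinus j k x + (if j < k then Kop j k x else 0) -
            (if μ k < μ j ∨ (μ k = μ j ∧ j < k) then x else 0)) +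
          τ • (X j * diffPlus j k x + (if j < k then (Top j * Top k * Kop j k) x else 0) -
            (if μ k < μ j ∨ (μ k = μ j ∧ j < k) then x else 0))) -
        (1 / (2 * ω) : ℂ) • dunkl τ a b j (dunkl τ a b j x) := by
    rw [hd]
    simp only [smul_sub, Finset.sum_add_distrib, Finset.sum_sub_distrib, smul_add,
      ← Finset.smul_sum, ← hrank]
    module
  rw [hfin]
  refine Submodule.sub_mem _ (Submodule.smul_mem _ _ (Submodule.sum_mem _ fun k hk => ?_))
    (Submodule.smul_mem _ _ (dunkl_dunkl_monomial_mem τ a b j μ))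
  have hk := Finset.ne_of_mem_erase hk
  exact Submodule.add_mem _ (diffMinus_monomial hk μ).2
    (Submodule.smul_mem _ _ (diffPlus_monomial hk μ).2)

/-! ### Joint eigenvectors of commuting triangular operators -/

/-- A commuting family of operators, triangular on monomials for the order `Below`, whose diagonal
entries separate the exponents. -/
structure IsTriangular {N : ℕ} (d : Fin N → Op N) (ev : Comp N → Fin N → ℂ) : Prop where
  comm : ∀ i j, d i * d j = d j * d i
  sub_mem : ∀ j μ, d j (monomial μ 1) - ev μ j • monomial μ 1 ∈ suppSub (fun ν => SBelow ν μ)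
  inj : ∀ μ ν, (∀ j, ev μ j = ev ν j) → μ = ν

/-- `f` is a joint eigenvector with the eigenvalues `v`. -/
def IsJoint {N : ℕ} (d : Fin N → Op N) (v : Fin N → ℂ) (f : Poly N) : Prop :=
  ∀ j, d j f = v j • f

namespace IsTriangular

variable {N : ℕ} {d : Fin N → Op N} {ev : Comp N → Fin N → ℂ}

/-- When no exponent of `f` lies strictly above `ν`, nothing but the diagonal entry can contribute
at `ν`. -/
theorem coeff_apply (hd : IsTriangular d ev) (j : Fin N) (ν : Comp N) {f : Poly N}
    (hf : f ∈ suppSub (fun κ => ¬SBelow ν κ)) : coeff ν (d j f) = ev ν j * coeff ν f := by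
  have key : (d j - ev ν j • 1) f ∈ suppSub (fun κ => κ ≠ ν) := by
    refine map_mem_of_monomial (P := fun κ => ¬SBelow ν κ) (fun κ hκ => ?_) hf
    have h1 : (d j - ev ν j • (1 : Op N)) (monomial κ 1) =
        (d j (monomial κ 1) - ev κ j • monomial κ 1) + (ev κ j - ev ν j) • monomial κ 1 := by
      simp only [LinearMap.sub_apply, LinearMap.smul_apply, Module.End.one_apply]
      module
    rw [h1]
    refine Submodule.add_mem _ (suppSub_mono (fun η hη e => ?_) (hd.sub_mem j κ)) ?_
    · exact hκ (e ▸ hη)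
    · by_cases e : κ = ν
      · rw [e, sub_self, zero_smul]; exact Submodule.zero_mem _
      · exact Submodule.smul_mem _ _ (monomial_mem_suppSub (P := fun κ => κ ≠ ν) e 1)
  by_contra hc
  refine key ν ?_ rfl
  simp only [LinearMap.sub_apply, LinearMap.smul_apply, Module.End.one_apply, coeff_sub,
    coeff_smul, smul_eq_mul]
  exact sub_ne_zero.2 hc

theorem apply_mem (hd : IsTriangular d ev) (j : Fin N) {μ : Comp N} {f : Poly N}
    (hf : f ∈ suppSub (fun κ => Below κ μ)) : d j f ∈ suppSub (fun κ => Below κ μ) := by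
  refine map_mem_of_monomial (P := fun κ => Below κ μ) (fun κ hκ => ?_) hf
  rw [← sub_add_cancel (d j (monomial κ 1)) (ev κ j • monomial κ 1)]
  refine Submodule.add_mem _ (suppSub_mono (fun η hη => hη.1.trans hκ) (hd.sub_mem j κ))
    (Submodule.smul_mem _ _ (monomial_mem_suppSub (P := fun κ => Below κ μ) hκ 1))

theorem isJoint_support (hd : IsTriangular d ev) {μ : Comp N} {g : Poly N}
    -- At an exponent `ν` maximal in the support, `coeff_apply` identifies the eigenvalues as `ev
    -- ν`; separation gives `ν = μ`, so every exponent lies below `μ`.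
    (hg : IsJoint d (ev μ) g) {κ : Comp N} (hκ : coeff κ g ≠ 0) :
    Below κ μ ∧ coeff μ g ≠ 0 := by
  obtain ⟨ν, h1, h2⟩ := @Finset.exists_le_maximal _ (belowOrder N).toPreorder κ g.support
    (mem_support_iff.2 hκ)
  have h3 : coeff ν g ≠ 0 := mem_support_iff.1 h2.1
  have h4 : g ∈ suppSub (fun κ => ¬SBelow ν κ) := fun η hη hlt =>
    hlt.2 (hlt.1.antisymm (h2.2 (mem_support_iff.2 hη) hlt.1))
  have h5 : ν = μ := hd.inj _ _ fun j => by
    have h6 := hd.coeff_apply j ν h4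
    rw [hg j, coeff_smul, smul_eq_mul] at h6
    exact (mul_right_cancel₀ h3 h6).symm
  subst h5
  exact ⟨h1, h3⟩

theorem isJoint_eq_zero (hd : IsTriangular d ev) {μ : Comp N} {g : Poly N}
    (hg : IsJoint d (ev μ) g) (h : coeff μ g = 0) : g = 0 := by
  ext κ
  by_contra hκ
  exact (hd.isJoint_support hg hκ).2 h

theorem isJoint_eq_smul (hd : IsTriangular d ev) {μ : Comp N} {g h : Poly N}
    (hg : IsJoint d (ev μ) g) (hh : IsJoint d (ev μ) h) (h1 : coeff μ h = 1) :
    g = coeff μ g • h := by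
  refine sub_eq_zero.1 (hd.isJoint_eq_zero (μ := μ) (fun j => ?_) ?_)
  · rw [map_sub, map_smul, hg j, hh j, smul_sub, smul_comm]
  · rw [coeff_sub, coeff_smul, h1, smul_eq_mul, mul_one, sub_self]

/-- An operator commuting with the family which kills a lower set of monomials. -/
theorem exists_annihilator (hd : IsTriangular d ev) (μ : Comp N) (n : ℕ) :
    ∀ S : Finset (Comp N), S.card = n → (∀ κ ∈ S, ∀ ν, SBelow ν κ → ν ∈ S) → μ ∉ S →
      ∃ (A : Op N) (c : ℂ), c ≠ 0 ∧ (∀ i, A * d i = d i * A) ∧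
        (∀ κ ∈ S, A (monomial κ 1) = 0) ∧
        ∀ f ∈ suppSub (fun κ => Below κ μ), coeff μ (A f) = c * coeff μ f := by
  classical
  induction n with
  | zero =>
    intro S hS _ _
    rw [Finset.card_eq_zero] at hS
    subst hS
    exact ⟨1, 1, one_ne_zero, fun i => by rw [one_mul, mul_one], by simp, by simp⟩
  | succ n ih =>
    intro S hS hlow hμ
    obtain ⟨κ, hκ⟩ := Finset.card_pos.1 (by omega : 0 < S.card)
    -- Removing a maximal `ν` leaves a lower set. The factor `d i - ev ν i` maps the span of `S`
    -- into that of `S.erase ν`, where `A` vanishes, and multiplies the coefficient at `μ` by `ev μ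
    -- i - ev ν i`, nonzero by the choice of `i`.
    obtain ⟨ν, -, hν⟩ := @Finset.exists_le_maximal _ (belowOrder N).toPreorder κ S hκ
    have hne : ν ≠ μ := fun e => hμ (e ▸ hν.1)
    obtain ⟨i, hi⟩ : ∃ i, ev μ i ≠ ev ν i := by
      by_contra hc
      push Not at hc
      exact hne (hd.inj _ _ hc).symm
    obtain ⟨A, c, hc, hcomm, hA, hcoeff⟩ := ih (S.erase ν)
      (by rw [Finset.card_erase_of_mem hν.1, hS, Nat.add_sub_cancel])
      (fun η hη ξ hξ => Finset.mem_erase.2 ⟨fun e => by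
        subst e
        exact hξ.2 (hξ.1.antisymm (hν.2 (Finset.mem_of_mem_erase hη) hξ.1)),
        hlow η (Finset.mem_of_mem_erase hη) ξ hξ⟩)
      (fun h => hμ (Finset.mem_of_mem_erase h))
    have hkill : ∀ f ∈ suppSub (fun κ => κ ∈ S.erase ν), A f = 0 := fun f hf => by
      have := map_mem_of_monomial (P := fun κ => κ ∈ S.erase ν) (L := ⊥) (A := A)
        (fun κ hκ => by rw [Submodule.mem_bot]; exact hA κ hκ) hf
      rwa [Submodule.mem_bot] at this
    refine ⟨A * (d i - ev ν i • 1), c * (ev μ i - ev ν i), mul_ne_zero hc (sub_ne_zero.2 hi),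
      fun k => ?_, fun η hη => ?_, fun f hf => ?_⟩
    · rw [mul_assoc, sub_mul, hd.comm i k, smul_mul_assoc, one_mul, ← mul_assoc, ← hcomm, mul_assoc,
        mul_sub (d k), mul_smul_comm, mul_one]
    · rw [Module.End.mul_apply]
      have h1 : (d i - ev ν i • (1 : Op N)) (monomial η 1) =
          (d i (monomial η 1) - ev η i • monomial η 1) + (ev η i - ev ν i) • monomial η 1 := by
        simp only [LinearMap.sub_apply, LinearMap.smul_apply, Module.End.one_apply]
        module
      refine hkill _ ?_
      rw [h1]
      refine Submodule.add_mem _ (suppSub_mono (fun ξ hξ => ?_) (hd.sub_mem i η)) ?_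
      · refine Finset.mem_erase.2 ⟨fun e => ?_, hlow η hη ξ hξ⟩
        subst e
        exact hξ.2 (hξ.1.antisymm (hν.2 hη hξ.1))
      · by_cases e : η = ν
        · rw [e, sub_self, zero_smul]; exact Submodule.zero_mem _
        · exact Submodule.smul_mem _ _ (monomial_mem_suppSub (P := fun κ => κ ∈ S.erase ν)
            (Finset.mem_erase.2 ⟨e, hη⟩) 1)
    · rw [Module.End.mul_apply]
      simp only [LinearMap.sub_apply, LinearMap.smul_apply, Module.End.one_apply]
      rw [hcoeff _ (Submodule.sub_mem _ (hd.apply_mem i hf) (Submodule.smul_mem _ _ hf)),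
        coeff_sub, coeff_smul, hd.coeff_apply i μ (suppSub_mono
          (fun κ hκ hlt => hlt.2 (hlt.1.antisymm hκ)) hf), smul_eq_mul]
      ring

theorem finite_sBelow (μ : Comp N) : {ν | SBelow ν μ}.Finite := by
  refine (Set.finite_Iic (Finsupp.equivFunOnFinite.symm fun _ => μ.degree)).subset fun ν hν i => ?_
  have h1 : ν.degree ≤ μ.degree := by
    rcases hν.1 with h | h
    exacts [h.degree_eq.le, h.le]
  exact (Finsupp.le_degree i ν).trans h1

/-- The defect `d j x^μ - ev μ j x^μ` lies in the span of the finitely many monomials strictly below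
`μ`. An operator commuting with the family and killing these turns `x^μ` into an eigenvector. -/
theorem exists_isJoint (hd : IsTriangular d ev) (μ : Comp N) :
    ∃ h, IsJoint d (ev μ) h ∧ coeff μ h = 1 := by
  have hmem : ∀ ν, ν ∈ (finite_sBelow μ).toFinset ↔ SBelow ν μ := fun ν => by simp
  obtain ⟨A, c, hc, hcomm, hA, hcoeff⟩ := hd.exists_annihilator μ _ (finite_sBelow μ).toFinset rfl
    (fun κ hκ ν hν => by
      rw [hmem] at hκ ⊢
      exact ⟨hν.1.trans hκ.1, fun e => hκ.2 (hκ.1.antisymm (e ▸ hν.1))⟩)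
    (fun h => ((hmem μ).1 h).2 rfl)
  refine ⟨c⁻¹ • A (monomial μ 1), fun j => ?_, ?_⟩
  · have h1 : A (d j (monomial μ 1) - ev μ j • monomial μ 1) = 0 := by
      have := map_mem_of_monomial (P := fun κ => SBelow κ μ) (L := ⊥) (A := A)
        (fun κ hκ => by rw [Submodule.mem_bot]; exact hA κ ((hmem κ).2 hκ)) (hd.sub_mem j μ)
      rwa [Submodule.mem_bot] at this
    have h2 := LinearMap.congr_fun (hcomm j) (monomial μ 1)
    rw [Module.End.mul_apply, Module.End.mul_apply] at h2
    rw [map_sub, map_smul, h2, sub_eq_zero] at h1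
    rw [map_smul, h1, smul_comm]
  · rw [coeff_smul, hcoeff _ (monomial_mem_suppSub (P := fun κ => Below κ μ) (Below.refl μ) 1),
      coeff_monomial, if_pos rfl, mul_one, smul_eq_mul, inv_mul_cancel₀ hc]

theorem isMonicTriangular (hd : IsTriangular d ev) {μ : Comp N} {h : Poly N}
    (hh : IsJoint d (ev μ) h) (h1 : coeff μ h = 1) : IsMonicTriangular μ h :=
  ⟨h1, fun _ _ hν => (hd.isJoint_support hh hν).1⟩

theorem existsUnique (hd : IsTriangular d ev) (μ : Comp N) :
    ∃! h, IsMonicTriangular μ h ∧ IsJoint d (ev μ) h := by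
  obtain ⟨h, h1, h2⟩ := hd.exists_isJoint μ
  refine ⟨h, ⟨hd.isMonicTriangular h1 h2, h1⟩, fun g hg => ?_⟩
  rw [hd.isJoint_eq_smul hg.2 h1 h2, hg.1.1, one_smul]

end IsTriangular

/-! ### The Cherednik operators as a triangular family -/

theorem weighted_apply {N : ℕ} (d : Fin N → Op N) (lam : Comp N) (f : Poly N) :
    weighted d lam f = ∑ j, (lam j : ℂ) • d j f := by
  simp [weighted, LinearMap.sum_apply]

theorem forall_weighted_iff {N : ℕ} (d : Fin N → Op N) (v : Fin N → ℝ) (h : Poly N) :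
    (∀ lam : Comp N, weighted d lam h = ((lam.vec ⬝ᵥ v : ℝ) : ℂ) • h) ↔
      IsJoint d (fun j => (v j : ℂ)) h := by
  constructor
  · intro H j
    have := H (Finsupp.single j 1)
    rw [weighted_apply, Finset.sum_eq_single j (fun i _ hi => by simp [Finsupp.single_eq_of_ne hi])
      (by simp)] at this
    rw [Finsupp.single_eq_same, Nat.cast_one, one_smul] at this
    rw [this, dotProduct, Finset.sum_eq_single j
      (fun i _ hi => by simp [Comp.vec, Finsupp.single_eq_of_ne hi]) (by simp)]
    simp [Comp.vec]
  · intro H lam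
    rw [weighted_apply, dotProduct]
    push_cast
    rw [Finset.sum_smul]
    refine Finset.sum_congr rfl fun j _ => ?_
    rw [H j, smul_smul]
    simp [Comp.vec]

/-- The eigenvalues of the Cherednik operators. -/
def eigen {N : ℕ} (τ a b : ℝ) (μ : Comp N) (j : Fin N) : ℂ :=
  ((spec ((1 + τ) * a) μ j + b : ℝ) : ℂ)

theorem isTriangular_cherednik {N : ℕ} {τ a b : ℝ} (h : IsType (τ : ℂ) b) (hτ : 0 ≤ τ)
    (ha : 0 ≤ a) (ω : ℝ) : IsTriangular (N := N) (cherednik τ a b ω) (eigen τ a b) where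
  comm := cherednik_comm h a ω
  sub_mem j μ := by
    have := cherednik_monomial h a ω j μ
    rwa [show eigen τ a b μ j = (μ j : ℂ) + a * (1 + τ) * rankAfter μ j + b by
      simp only [eigen, spec]; push_cast; ring]
  inj μ ν H := spec_injective (κ := (1 + τ) * a) (by positivity) fun j => by
    have := H j
    rw [eigen, eigen, Complex.ofReal_inj] at this
    exact add_right_cancel this

/-! ### The action of the braid operators on the eigenvectors -/

theorem coeff_Kop {N : ℕ} (j k : Fin N) (μ : Comp N) (f : Poly N) :
    coeff (Comp.act (Equiv.swap j k) μ) (Kop j k f) = coeff μ f := by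
  rw [Comp.act, Finsupp.equivMapDomain_eq_mapDomain]
  exact coeff_rename_mapDomain _ (Equiv.injective _) _ _

theorem coeff_Top {N : ℕ} (j : Fin N) (μ : Comp N) (f : Poly N) :
    coeff μ (Top j f) = (-1) ^ μ j * coeff μ f := by
  induction f using MvPolynomial.induction_on' with
  | monomial ν c =>
    rw [Top_monomial, coeff_smul, coeff_monomial, smul_eq_mul]
    split_ifs with e
    · rw [e]
    · simp
  | add p q hp hq => rw [map_add, coeff_add, coeff_add, hp, hq, mul_add]

/-- The two-valued factor `1 + τ (-1)^{μ_j - μ_{j+1}}`. -/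
def parityFactor {N : ℕ} (τ : ℂ) (j : Fin (N - 1)) (μ : Comp N) : ℂ :=
  1 + τ * (-1) ^ (μ (lo j) + μ (hi j))

theorem act_simpleRefl_simpleRefl {N : ℕ} (j : Fin (N - 1)) (μ : Comp N) :
    Comp.act (simpleRefl j) (Comp.act (simpleRefl j) μ) = μ := by
  rw [act_act, simpleRefl_mul_self]; ext i; rfl

theorem act_simpleRefl_apply {N : ℕ} (j : Fin (N - 1)) (μ : Comp N) (i : Fin N) :
    Comp.act (simpleRefl j) μ i = μ (simpleRefl j i) := by
  rw [Comp.act_apply, simpleRefl, Equiv.swap_inv]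

theorem simpleRefl_lo {N : ℕ} (j : Fin (N - 1)) : simpleRefl j (lo j) = hi j :=
  Equiv.swap_apply_left _ _

theorem simpleRefl_hi {N : ℕ} (j : Fin (N - 1)) : simpleRefl j (hi j) = lo j :=
  Equiv.swap_apply_right _ _

theorem simpleRefl_mul_inv_apply {N : ℕ} (j : Fin (N - 1)) (w : Equiv.Perm (Fin N)) (i : Fin N) :
    (simpleRefl j * w)⁻¹ i = w⁻¹ (simpleRefl j i) := by
  rw [mul_inv_rev, Equiv.Perm.mul_apply, simpleRefl, Equiv.swap_inv]

theorem IsSort.simpleRefl_mul {N : ℕ} {μ : Comp N} {w : Equiv.Perm (Fin N)} (h : IsSort μ w)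
    (j : Fin (N - 1)) (hne : μ (lo j) ≠ μ (hi j)) :
    IsSort (Comp.act (simpleRefl j) μ) (simpleRefl j * w) := by
  intro p q
  rw [simpleRefl_mul_inv_apply, simpleRefl_mul_inv_apply, h, act_simpleRefl_apply,
    act_simpleRefl_apply]
  by_cases h1 : p = lo j ∧ q = hi j
  · rw [h1.1, h1.2, simpleRefl_lo, simpleRefl_hi]
    simp [hne.symm]
  · by_cases h2 : p = hi j ∧ q = lo j
    · rw [h2.1, h2.2, simpleRefl_lo, simpleRefl_hi]
      simp [hne]
    · rw [simpleRefl_lt_iff j h1 h2]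

theorem rankAfter_act_simpleRefl {N : ℕ} {μ : Comp N} (j : Fin (N - 1))
    (hne : μ (lo j) ≠ μ (hi j)) (i : Fin N) :
    rankAfter (Comp.act (simpleRefl j) μ) i = rankAfter μ (simpleRefl j i) := by
  have h1 := (isSort_shortest μ).inv_add_rankAfter (simpleRefl j i)
  have h2 := ((isSort_shortest μ).simpleRefl_mul j hne).inv_add_rankAfter i
  rw [simpleRefl_mul_inv_apply] at h2
  omega

theorem eigen_act_simpleRefl {N : ℕ} (τ a b : ℝ) {μ : Comp N} (j : Fin (N - 1))
    (hne : μ (lo j) ≠ μ (hi j)) (i : Fin N) :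
    eigen τ a b (Comp.act (simpleRefl j) μ) i = eigen τ a b μ (simpleRefl j i) := by
  rw [eigen, eigen, spec, spec, rankAfter_act_simpleRefl j hne, act_simpleRefl_apply]

/-- The product of twists commutes with all `d_i`, hence acts on the one-dimensional joint
eigenspace by a scalar, which is read off at the leading monomial. -/
theorem twist_twist_apply {N : ℕ} {τ a b : ℝ} (h : IsType (τ : ℂ) b) (hτ : 0 ≤ τ)
    (ha : 0 ≤ a) (ω : ℝ) {μ : Comp N} {f : Poly N}
    (hf : IsJoint (cherednik τ a b ω) (eigen τ a b μ) f) (h1 : coeff μ f = 1)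
    (j : Fin (N - 1)) :
    (1 + twist (τ : ℂ) (lo j) * twist (τ : ℂ) (hi j)) f = parityFactor τ j μ • f := by
  have hd := isTriangular_cherednik (N := N) h hτ ha ω
  have hg : IsJoint (cherednik τ a b ω) (eigen τ a b μ)
      ((twist (τ : ℂ) (lo j) * twist (τ : ℂ) (hi j)) f) := fun i => by
    have hc : cherednik (τ : ℂ) a b ω i * (twist (τ : ℂ) (lo j) * twist (τ : ℂ) (hi j)) =
        (twist (τ : ℂ) (lo j) * twist (τ : ℂ) (hi j)) * cherednik (τ : ℂ) a b ω i := by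
      rw [← mul_assoc, ← twist_mul_cherednik h, mul_assoc, ← twist_mul_cherednik h, mul_assoc]
    have hc' : cherednik (τ : ℂ) a b ω i ((twist (τ : ℂ) (lo j) * twist (τ : ℂ) (hi j)) f) =
        (twist (τ : ℂ) (lo j) * twist (τ : ℂ) (hi j)) (cherednik (τ : ℂ) a b ω i f) :=
      LinearMap.congr_fun hc f
    rw [hc', hf i, map_smul]
  have hc : coeff μ ((twist (τ : ℂ) (lo j) * twist (τ : ℂ) (hi j)) f) =
      τ * (-1) ^ (μ (lo j) + μ (hi j)) := by
    rw [twist_mul_twist h, LinearMap.smul_apply, coeff_smul, Module.End.mul_apply, coeff_Top,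
      coeff_Top, h1, pow_add, smul_eq_mul, mul_one]
  rw [LinearMap.add_apply, Module.End.one_apply, hd.isJoint_eq_smul hg hf h1, hc, parityFactor,
    add_smul, one_smul]

/-- The span of `f` and `g` is stable under `K_{j,j+1}` and `d_j`, and the Hecke relations determine
both on it. With `c = aε / (x - y)` one has `f = K g + c g`, and the commutator sends `f` to `(x -
y)(1 - c²) g`. -/
theorem braid_apply {N : ℕ} {τ a b : ℝ} (h : IsType (τ : ℂ) b) (hτ : 0 ≤ τ)
    (ha : 0 ≤ a) (ω : ℝ) {μ : Comp N} {f g : Poly N} (j : Fin (N - 1))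
    (hlt : μ (hi j) < μ (lo j))
    (hf : IsJoint (cherednik τ a b ω) (eigen τ a b μ) f) (hf1 : coeff μ f = 1)
    (hg : IsJoint (cherednik τ a b ω) (eigen τ a b (Comp.act (simpleRefl j) μ)) g)
    (hg1 : coeff (Comp.act (simpleRefl j) μ) g = 1)
    (he : eigen τ a b μ (lo j) - eigen τ a b μ (hi j) ≠ 0) :
    braid (cherednik τ a b ω) j f =
      (((eigen τ a b μ (lo j) - eigen τ a b μ (hi j)) ^ 2 - a ^ 2 * parityFactor τ j μ ^ 2) /
        (eigen τ a b μ (lo j) - eigen τ a b μ (hi j))) • g := by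
  have hd := isTriangular_cherednik (N := N) h hτ ha ω
  have hev := eigen_act_simpleRefl τ a b j hlt.ne'
  have hTg := twist_twist_apply h hτ ha ω hg hg1 j
  have hTf := twist_twist_apply h hτ ha ω hf hf1 j
  have hε : parityFactor (τ : ℂ) j (Comp.act (simpleRefl j) μ) = parityFactor τ j μ := by
    rw [parityFactor, parityFactor, act_simpleRefl_apply, act_simpleRefl_apply, simpleRefl_lo,
      simpleRefl_hi, add_comm (μ _)]
  rw [hε] at hTg
  set d := cherednik (N := N) τ a b ω
  set K : Op N := Kop (lo j) (hi j) with hK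
  set ε := parityFactor (τ : ℂ) j μ
  set x := eigen τ a b μ (lo j)
  set y := eigen τ a b μ (hi j)
  have hgl : d (lo j) g = y • g := by rw [hg, hev, simpleRefl_lo]
  have hgh : d (hi j) g = x • g := by rw [hg, hev, simpleRefl_hi]
  have hlo : ∀ p, K (d (lo j) p) = d (hi j) (K p) +
      (a : ℂ) • (1 + twist (τ : ℂ) (lo j) * twist (τ : ℂ) (hi j)) p := fun p =>
    LinearMap.congr_fun (Kop_mul_cherednik_lo h a ω j) p
  have hhi : ∀ p, K (d (hi j) p) +
      (a : ℂ) • (1 + twist (τ : ℂ) (lo j) * twist (τ : ℂ) (hi j)) p = d (lo j) (K p) := fun p =>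
    LinearMap.congr_fun (Kop_mul_cherednik_hi h a ω j) p
  have hlog : d (lo j) (K g) = x • K g + (a * ε) • g := by
    rw [← hhi, hgh, hTg, map_smul, smul_smul]
  have hhig : d (hi j) (K g) = y • K g - (a * ε) • g := by
    have := hlo g
    rw [hgl, hTg, map_smul, smul_smul] at this
    rw [this, add_sub_cancel_right]
  -- The coefficient solves `aε + c y = c x`, so that `d_j` acts by `x`; the same `c` makes
  -- `d_{j+1}` act by `y`.
  have hjoint : IsJoint d (eigen τ a b μ) (K g + (a * ε / (x - y)) • g) := by
    intro i
    rw [map_add, map_smul]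
    by_cases h1 : i = lo j
    · subst h1
      rw [hlog, hgl, smul_add, smul_smul, smul_smul, add_assoc, ← add_smul]
      congr 2
      field_simp
      ring
    · by_cases h2 : i = hi j
      · subst h2
        rw [hhig, hgh, smul_add, smul_smul, smul_smul, sub_add_eq_add_sub, add_sub_assoc, ← sub_smul]
        congr 2
        field_simp
        ring
      · have hc := LinearMap.congr_fun (Kop_mul_cherednik_of_ne h a ω j h1 h2) g
        rw [Module.End.mul_apply, Module.End.mul_apply] at hc
        have h3 : simpleRefl j i = i := Equiv.swap_apply_of_ne_of_ne h1 h2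
        rw [← hc, hg i, hev, h3, map_smul, smul_add, smul_comm]
  -- The exponents of `g` lie below `s_j μ`, which is strictly below `μ`; so only `K g` contributes
  -- to the leading coefficient.
  have hnot : coeff μ g = 0 := by
    by_contra hc
    have h1 := (hd.isJoint_support hg hc).1
    have h2 := SBelow.swap (lo_lt_hi j) hlt
    exact h2.2 (h2.1.antisymm h1)
  have hfeq : f = K g + (a * ε / (x - y)) • g := by
    have := hd.isJoint_eq_smul hjoint hf hf1
    rw [this, coeff_add, coeff_smul, hnot, smul_zero, add_zero]
    have h1 := coeff_Kop (lo j) (hi j) (Comp.act (simpleRefl j) μ) g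
    rw [show Comp.act (Equiv.swap (lo j) (hi j)) (Comp.act (simpleRefl j) μ) = μ from
      act_simpleRefl_simpleRefl j μ, hg1] at h1
    rw [h1, one_smul]
  have hKK : K (K g) = g := LinearMap.congr_fun (Kop_mul_self (lo j) (hi j)) g
  have hKg : K g = f - (a * ε / (x - y)) • g := by rw [hfeq, add_sub_cancel_right]
  have hKf : K f = g + (a * ε / (x - y)) • (f - (a * ε / (x - y)) • g) := by
    rw [← hKg]
    conv_lhs => rw [hfeq]
    rw [map_add, map_smul, hKK]
  have hbr : braid d j f = K (d (lo j) f) - d (lo j) (K f) := rfl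
  rw [hbr, hf (lo j), map_smul, hKf]
  simp only [map_add, map_sub, map_smul, hgl, hf (lo j)]
  have hz : x - y ≠ 0 := he
  have e1 : ((x - y) ^ 2 - a ^ 2 * ε ^ 2) / (x - y) = (x - y) - (a * ε / (x - y)) ^ 2 * (x - y) := by
    field_simp
  rw [e1]
  change x • (g + (a * ε / (x - y)) • (f - (a * ε / (x - y)) • g)) -
    (y • g + (a * ε / (x - y)) • (x • f - (a * ε / (x - y)) • y • g)) = _
  module

/-! ### Normalisation constants and induction along a reduced word -/

/-- The factor of the normalisation constant which belongs to the root `α`. -/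
def rootFactor {N : ℕ} (τ a : ℝ) (μp : Comp N) (α : Fin N → ℝ) : ℝ :=
  ((pair ((1 + τ) * a) α μp) ^ 2 - a ^ 2 * (1 + τ * parity α μp) ^ 2) / pair ((1 + τ) * a) α μp

theorem coroot_eps_sub {N : ℕ} {i k : Fin N} (h : i ≠ k) :
    coroot (eps i - eps k : Fin N → ℝ) = eps i - eps k := by
  have h2 : (eps i - eps k : Fin N → ℝ) ⬝ᵥ (eps i - eps k) = 2 := by
    simp [eps, dotProduct_sub, h, h.symm]
    norm_num
  rw [coroot, h2]
  norm_num

theorem pair_eps_sub {N : ℕ} {i k : Fin N} (h : i ≠ k) (κ : ℝ) (μ : Comp N) :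
    pair κ (eps i - eps k) μ = (μ i + κ * rho N i) - (μ k + κ * rho N k) := by
  rw [pair, coroot_eps_sub h]
  simp [eps, sub_dotProduct, Comp.vec]
  ring

theorem parity_eps_sub {N : ℕ} {i k : Fin N} (h : i ≠ k) (μ : Comp N) :
    parity (eps i - eps k) μ = (-1) ^ (μ i + μ k) := by
  have h1 : (eps i - eps k : Fin N → ℝ) ⬝ᵥ μ.vec = ((μ i - μ k : ℤ) : ℝ) := by
    simp [eps, sub_dotProduct, Comp.vec]
  have h2 : ((-1 : ℝ) ^ (μ k)) ≠ 0 := pow_ne_zero _ (by norm_num)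
  rw [parity, coroot_eps_sub h, h1, Int.floor_intCast, zpow_sub₀ (by norm_num), zpow_natCast,
    zpow_natCast, div_eq_iff h2, pow_add, mul_assoc, ← mul_pow]
  norm_num

theorem IsSort.pair_eq {N : ℕ} {μ μp : Comp N} {w : Equiv.Perm (Fin N)} (hw : IsSort μ w)
    (hμ : Comp.act w⁻¹ μ = μp) {p q : Fin N} (hpq : p ≠ q) (κ : ℝ) :
    pair κ (eps (w⁻¹ p) - eps (w⁻¹ q)) μp = spec κ μ p - spec κ μ q := by
  rw [pair_eps_sub (w⁻¹.injective.ne hpq), ← hμ, Comp.act_apply, Comp.act_apply, inv_inv,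
    perm_apply_inv_self, perm_apply_inv_self, hw.rho_inv, hw.rho_inv, spec, spec]
  ring

/-- A stable sort never inverts equal entries. At an inversion the entries therefore differ by at
least one, and so do the ranks. -/
theorem IsSort.one_add_le_pair {N : ℕ} {μ μp : Comp N} {w : Equiv.Perm (Fin N)} (hw : IsSort μ w)
    (hμ : Comp.act w⁻¹ μ = μp) {κ : ℝ} (hκ : 0 ≤ κ) {α : Fin N → ℝ} (hα : α ∈ inversions w) :
    1 + κ ≤ pair κ α μp := by
  classical
  rw [inversions_eq, Finset.mem_image] at hα
  obtain ⟨⟨i, k⟩, hik, rfl⟩ := hα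
  obtain ⟨h1, h2⟩ := mem_posInv.1 hik
  have h3 := (hw (w i) (w k)).1 (by simpa only [perm_inv_apply_self] using h1)
  have h4 : μ (w k) < μ (w i) := by
    rcases h3 with h | h
    · exact h
    · exact absurd h.2 h2.not_gt
  have h5 := rankAfter_lt (Or.inl h4)
  have h6 := hw.pair_eq hμ h2.ne' κ
  rw [perm_inv_apply_self, perm_inv_apply_self] at h6
  simp only
  rw [h6, spec, spec]
  have h7 : (μ (w k) : ℝ) + 1 ≤ μ (w i) := by exact_mod_cast h4
  have h8 : (rankAfter μ (w k) : ℝ) + 1 ≤ rankAfter μ (w i) := by exact_mod_cast h5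
  have := mul_le_mul_of_nonneg_left h8 hκ
  linarith

theorem parity_eq_of_mem {N : ℕ} {w : Equiv.Perm (Fin N)} (μ : Comp N) {α : Fin N → ℝ}
    (hα : α ∈ inversions w) : parity α μ = 1 ∨ parity α μ = -1 := by
  classical
  rw [inversions_eq, Finset.mem_image] at hα
  obtain ⟨⟨i, k⟩, hik, rfl⟩ := hα
  simp only
  rw [parity_eps_sub (mem_posInv.1 hik).1.ne]
  exact neg_one_pow_eq_or ℝ _

/-- The pairing is at least `1 + (1 + τ)a`, which exceeds `a |1 + τ (±1)|`. -/
theorem IsSort.rootFactor_ne_zero {N : ℕ} {μ μp : Comp N} {w : Equiv.Perm (Fin N)}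
    (hw : IsSort μ w) (hμ : Comp.act w⁻¹ μ = μp) {τ a : ℝ} (hτ : 0 ≤ τ) (ha : 0 ≤ a)
    {α : Fin N → ℝ} (hα : α ∈ inversions w) : rootFactor τ a μp α ≠ 0 := by
  have hκ : 0 ≤ (1 + τ) * a := by positivity
  have h1 := hw.one_add_le_pair hμ hκ hα
  refine div_ne_zero (ne_of_gt ?_) (by linarith)
  have h2 : (1 + τ * parity α μp) ^ 2 ≤ (1 + τ) ^ 2 := by
    rcases parity_eq_of_mem μp hα with h | h <;> rw [h] <;> nlinarith
  have h3 := mul_le_mul_of_nonneg_left h2 (sq_nonneg a)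
  nlinarith

/-- Induction on the word, splitting off its head, the letter applied last. The tail leads to `s_j
μ`, and the head adds the inversion of `posInv_simpleRefl_mul`, whose pairing is the eigenvalue
difference in `braid_apply`. -/
theorem braidWord_apply {N : ℕ} {τ a b : ℝ} (h : IsType (τ : ℂ) b) (hτ : 0 ≤ τ)
    (ha : 0 ≤ a) (ω : ℝ) {μp : Comp N} {fp : Poly N}
    (hfp : IsJoint (cherednik τ a b ω) (eigen τ a b μp) fp) (hfp1 : coeff μp fp = 1)
    (js : List (Fin (N - 1))) :
    ∀ (w : Equiv.Perm (Fin N)) (μ : Comp N) (f : Poly N), IsSort μ w → Comp.act w⁻¹ μ = μp →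
      IsReducedWord w js → IsJoint (cherednik τ a b ω) (eigen τ a b μ) f → coeff μ f = 1 →
      braidWord (cherednik τ a b ω) js fp =
        ((∏ α ∈ inversions w, rootFactor τ a μp α : ℝ) : ℂ) • f := by
  have hd := isTriangular_cherednik (N := N) h hτ ha ω
  induction js with
  | nil =>
    rintro w μ f - hμ ⟨hw, -⟩ hf hf1
    simp only [List.map_nil, List.prod_nil] at hw
    subst hw
    have hμ' : μ = μp := by rw [← hμ]; ext i; rfl
    subst hμ'
    have h1 : inversions (1 : Equiv.Perm (Fin N)) = ∅ := Finset.card_eq_zero.1 length_one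
    rw [h1, Finset.prod_empty, Complex.ofReal_one, one_smul, hd.isJoint_eq_smul hfp hf hf1, hfp1,
      one_smul]
    rfl
  | cons j js ih =>
    intro w μ f hw hμ hjs hf hf1
    obtain ⟨hjs', hinv⟩ := hjs.tail
    have hlt : μ (lo j) < μ (hi j) := by
      rcases (hw _ _).1 hinv with h1 | h1
      · exact h1
      · exact absurd h1.2 (lo_lt_hi j).not_gt
    set μ' := Comp.act (simpleRefl j) μ with hμ'
    set w' := simpleRefl j * w with hw'
    have hw'sort : IsSort μ' w' := hw.simpleRefl_mul j hlt.ne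
    have hμ'p : Comp.act w'⁻¹ μ' = μp := by
      rw [hμ', hw', act_act, mul_inv_rev, mul_assoc, inv_mul_cancel, mul_one, hμ]
    obtain ⟨g, hg, hg1⟩ := hd.exists_isJoint μ'
    have hback : Comp.act (simpleRefl j) μ' = μ := act_simpleRefl_simpleRefl j μ
    have hlt' : μ' (hi j) < μ' (lo j) := by
      rw [hμ', act_simpleRefl_apply, act_simpleRefl_apply, simpleRefl_lo, simpleRefl_hi]
      exact hlt
    have hwlt : w'⁻¹ (lo j) < w'⁻¹ (hi j) := by
      rw [hw', simpleRefl_mul_inv_apply, simpleRefl_mul_inv_apply, simpleRefl_lo, simpleRefl_hi]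
      exact hinv
    have hww : w = simpleRefl j * w' := by
      rw [hw', ← mul_assoc, simpleRefl_mul_self, one_mul]
    have hpair := hw'sort.pair_eq hμ'p (lo_ne_hi j) ((1 + τ) * a)
    have hε : parityFactor (τ : ℂ) j μ' =
        ((1 + τ * parity (eps (w'⁻¹ (lo j)) - eps (w'⁻¹ (hi j))) μp : ℝ) : ℂ) := by
      have hp : ∀ q, μp (w'⁻¹ q) = μ' q := fun q => by
        rw [← hμ'p]
        exact congrArg μ' (perm_apply_inv_self w' q)
      rw [parity_eps_sub hwlt.ne, hp, hp, parityFactor]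
      push_cast
      rfl
    have hdiff : eigen τ a b μ' (lo j) - eigen τ a b μ' (hi j) =
        ((pair ((1 + τ) * a) (eps (w'⁻¹ (lo j)) - eps (w'⁻¹ (hi j))) μp : ℝ) : ℂ) := by
      rw [hpair, eigen, eigen]
      push_cast
      ring
    have hmem : (eps (w'⁻¹ (lo j)) - eps (w'⁻¹ (hi j)) : Fin N → ℝ) ∈ inversions w := by
      classical
      rw [inversions_eq, hww, posInv_simpleRefl_mul j w' hwlt]
      exact Finset.mem_image_of_mem _ (Finset.mem_insert_self _ _)
    have hpos := hw.one_add_le_pair hμ (by positivity : 0 ≤ (1 + τ) * a) hmem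
    have hκ : 0 ≤ (1 + τ) * a := by positivity
    have hbraid := braid_apply h hτ ha ω j hlt' hg hg1 (g := f) (by rw [hback]; exact hf)
      (by rw [hback]; exact hf1) (by
        rw [hdiff]
        exact Complex.ofReal_ne_zero.2 (by linarith))
    have hword : braidWord (cherednik (τ : ℂ) a b ω) (j :: js) fp =
        braid (cherednik (τ : ℂ) a b ω) j (braidWord (cherednik (τ : ℂ) a b ω) js fp) := by
      rw [braidWord, List.map_cons, List.prod_cons]; rfl
    rw [hword, ih w' μ' g hw'sort hμ'p hjs' hg hg1, map_smul, hbraid, smul_smul, prod_inversions w,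
      hww, posInv_simpleRefl_mul j w' hwlt, Finset.prod_insert (notMem_posInv j w'),
      ← prod_inversions w', hdiff, hε]
    congr 1
    rw [rootFactor]
    push_cast
    ring

/-- The relation between the eigenvectors of an orbit, for both types at once. -/
theorem epsilon_eq_smul_braidWord {N : ℕ} {τ a b : ℝ} (h : IsType (τ : ℂ) b) (hτ : 0 ≤ τ) (ha : 0 ≤ a) (ω : ℝ)
    (μ μp : Comp N) (hμp : μp.IsPartition) (hμ : μ ∈ μp.orbit) (js : List (Fin (N - 1)))
    (hjs : IsReducedWord (shortest μ) js) (P : Comp N → Poly N → Prop)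
    (hP : ∀ ν f, P ν f ↔ IsMonicTriangular ν f ∧ IsJoint (cherednik τ a b ω) (eigen τ a b ν) f) :
    (∃! f, P μ f) ∧ (∃! f, P μp f) ∧
      (∀ α ∈ inversions (shortest μ), pair ((1 + τ) * a) α μp ≠ 0) ∧
      ∏ α ∈ inversions (shortest μ), rootFactor τ a μp α ≠ 0 ∧
      Classical.epsilon (P μ) =
        ((∏ α ∈ inversions (shortest μ), rootFactor τ a μp α : ℝ) : ℂ)⁻¹ •
          braidWord (cherednik τ a b ω) js (Classical.epsilon (P μp)) := by
  have hd := isTriangular_cherednik (N := N) h hτ ha ω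
  have hex : ∀ ν, ∃! f, P ν f := fun ν => by simpa only [hP] using hd.existsUnique ν
  have hsort := isSort_shortest μ
  have hplus : Comp.act (shortest μ)⁻¹ μ = μp := plus_eq_of_mem_orbit hμp hμ
  have hκ : 0 ≤ (1 + τ) * a := by positivity
  have hprod : ∏ α ∈ inversions (shortest μ), rootFactor τ a μp α ≠ 0 :=
    Finset.prod_ne_zero_iff.2 fun α hα => hsort.rootFactor_ne_zero hplus hτ ha hα
  refine ⟨hex μ, hex μp, fun α hα => ?_, hprod, ?_⟩
  · have := hsort.one_add_le_pair hplus hκ hα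
    linarith
  · obtain ⟨h1, h2⟩ := (hP _ _).1 (Classical.epsilon_spec (hex μ).exists)
    obtain ⟨h3, h4⟩ := (hP _ _).1 (Classical.epsilon_spec (hex μp).exists)
    rw [braidWord_apply h hτ ha ω h4 h3.1 js _ μ _ hsort hplus hjs h2 h1.1, smul_smul,
      inv_mul_cancel₀ (Complex.ofReal_ne_zero.2 hprod), one_smul]

/-- The constant `-(N - 1)/2` in `rhoAt_apply`, multiplied by `a`, cancels the shift in the
eigenvalue and leaves `spec a`. In type B both carry the factor `2a` and cancel likewise, up to the
summand `b`. -/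
theorem isHermite_iff {N : ℕ} {a ω : ℝ} (hω : 0 < ω) (μ : Comp N) (f : Poly N) :
    IsHermite a ω μ f ↔ IsMonicTriangular μ f ∧
      IsJoint (cherednik ((0 : ℝ) : ℂ) a ((0 : ℝ) : ℂ) ω) (eigen 0 a 0 μ) f := by
  rw [IsHermite, forall_weighted_iff, cherednikA_eq hω, Complex.ofReal_zero]
  have : (fun j => (((μ.vec + a • rhoAt μ + (1 / 2 * a * ((N : ℝ) - 1)) • 1) j : ℝ) : ℂ)) =
      eigen 0 a 0 μ := by
    funext j
    simp only [eigen, spec, Pi.add_apply, Pi.smul_apply, Pi.one_apply, rhoAt_apply, Comp.vec,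
      smul_eq_mul]
    congr 1
    ring
  rw [this]

theorem isLaguerre_iff {N : ℕ} {a b ω : ℝ} (hω : 0 < ω) (μ : Comp N) (f : Poly N) :
    IsLaguerre a b ω μ f ↔ IsMonicTriangular μ f ∧
      IsJoint (cherednik ((1 : ℝ) : ℂ) a b ω) (eigen 1 a b μ) f := by
  rw [IsLaguerre, forall_weighted_iff, cherednikB_eq hω, Complex.ofReal_one]
  have : (fun j => (((μ.vec + (2 * a) • rhoAt μ + (a * ((N : ℝ) - 1) + b) • 1) j : ℝ) : ℂ)) =
      eigen 1 a b μ := by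
    funext j
    simp only [eigen, spec, Pi.add_apply, Pi.smul_apply, Pi.one_apply, rhoAt_apply, Comp.vec,
      smul_eq_mul]
    congr 1
    ring
  rw [this]

end

end Calogero

theorem mainTheorem3 {N : ℕ} (a b ω : ℝ) (ha : 0 ≤ a) (hb : 0 ≤ b) (hω : 0 < ω)
    (μ μp : Calogero.Comp N) (hμp : μp.IsPartition) (hμ : μ ∈ μp.orbit)
    (js : List (Fin (N - 1))) (hjs : Calogero.IsReducedWord (Calogero.shortest μ) js) :
    ((∃! h, Calogero.IsHermite a ω μ h) ∧ (∃! h, Calogero.IsHermite a ω μp h) ∧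
      (∀ α ∈ Calogero.inversions (Calogero.shortest μ), Calogero.pair a α μp ≠ 0) ∧
      Calogero.cA a (Calogero.shortest μ) μp ≠ 0 ∧
      Calogero.hermite a ω μ =
        ((Calogero.cA a (Calogero.shortest μ) μp : ℝ) : ℂ)⁻¹ •
          Calogero.braidWord (Calogero.cherednikA a ω) js (Calogero.hermite a ω μp)) ∧
    ((∃! h, Calogero.IsLaguerre a b ω μ h) ∧ (∃! h, Calogero.IsLaguerre a b ω μp h) ∧
      (∀ α ∈ Calogero.inversions (Calogero.shortest μ), Calogero.pair (2 * a) α μp ≠ 0) ∧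
      Calogero.cB a (Calogero.shortest μ) μp ≠ 0 ∧
      Calogero.laguerre a b ω μ =
        ((Calogero.cB a (Calogero.shortest μ) μp : ℝ) : ℂ)⁻¹ •
          Calogero.braidWord (Calogero.cherednikB a b ω) js
            (Calogero.laguerre a b ω μp)) := by
  constructor
  · have hc : Calogero.cA a (Calogero.shortest μ) μp =
        ∏ α ∈ Calogero.inversions (Calogero.shortest μ), Calogero.rootFactor 0 a μp α :=
      Finset.prod_congr rfl fun α _ => by simp [Calogero.rootFactor]
    have := Calogero.epsilon_eq_smul_braidWord (τ := 0) (b := 0) (Or.inl (by simp)) le_rfl ha ω μ μp hμp hμ js hjs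
      (Calogero.IsHermite a ω) (Calogero.isHermite_iff hω)
    rw [add_zero, one_mul] at this
    rw [hc, Calogero.cherednikA_eq hω, Calogero.hermite, Calogero.hermite]
    simpa only [Complex.ofReal_zero] using this
  · have hc : Calogero.cB a (Calogero.shortest μ) μp =
        ∏ α ∈ Calogero.inversions (Calogero.shortest μ), Calogero.rootFactor 1 a μp α :=
      Finset.prod_congr rfl fun α _ => by
        rw [Calogero.rootFactor, one_mul, one_add_one_eq_two]
    have := Calogero.epsilon_eq_smul_braidWord (τ := 1) (b := b) (Or.inr (by simp)) zero_le_one ha ω μ μp hμp hμ js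
      hjs (Calogero.IsLaguerre a b ω) (Calogero.isLaguerre_iff hω)
    rw [one_add_one_eq_two] at this
    rw [hc, Calogero.cherednikB_eq hω, Calogero.laguerre, Calogero.laguerre]
    simpa only [Complex.ofReal_one] using this
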